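/- Logarithms are to base 2. For a finite set $S\subset\mathbb R^2$ and $q=(q_x,q_y)\in\mathbb R^2$, the 2-sided range counting query $q$ asks for the number of $p\in S$ with $p_x\ge q_x$ and $p_y\ge q_y$. A comparison tree is a finite binary tree in which every internal node compares $q_x$ or $q_y$ to a fixed real number and every leaf carries a number; it answers range counting over $S$ if for every $q\in\mathbb R^2$ the leaf reached by $q$ carries the answer to the query $q$. For a probability measure $D$ on $\mathbb R^2$, $\mu_D(T^*)$ is the expected number of comparisons made by the comparison tree $T^*$ on a query drawn from $D$. **Biased range trees.** Let $S$ have $n\ge 1$ points, and fix integer constants $\kappa\ge 0$ and $\rho\ge 1$. A biased range tree $T$ for $(S,D)$ consists of the following. *Primary tree.* Every node $v$ has a region $r(v)$, which is $\mathbb R^2$ for the root. A node is split if its depth is less than $\lceil\log n\rceil$ and $r(v)\cap S\ne\emptyset$; otherwise it is a leaf, which is called bad if $r(v)\cap S\neq\emptyset$. At even depth, cut $r(v)$ by the vertical lines through the points of $r(v)\cap S$ into strips that are open on the left and closed on the right; $s(v)$ is a strip such that the parts of $r(v)$ to its left and to its right have probability at most $\Pr(r(v))/2$ each, the right one less than $\Pr(r(v))/2$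 if $\Pr(r(v))>0$. The parts to the left and to the right are the regions of the left and right child. At odd depth the same is done with horizontal lines, from bottom to top. For a leaf, $s(v)=r(v)$. *Catalogues.* Every node $v$ has two catalogues $C_x(v),C_y(v)\subseteq S$. If $v$ is the left child of $w$, then $C_y(v)$ (if $w$ has even depth) or $C_x(v)$ (if $w$ has odd depth) is $S\cap r(w)\setminus r(v)$; all other catalogues are empty. By fractional cascading, $v$ stores the sorted list of the $x$-coordinates of $C_x(v)$ together with every $\rho$-th entry of the corresponding list stored at its parent, and likewise for $y$. For every interval $(a,b]$ between consecutive entries of a stored list, tables give the number of points of the catalogue that are not before the interval, and the position in the parent's list from which to search. Every stored list is indexed by a biased search tree, i.e. a search tree whose expected number of comparisons is at most $\sum_i p_i\log(1/p_i)+\kappa$, where $p_i$ are the probabilities of the intervals under $D$ conditioned on $s(w)$ if $v$ is the left child of $w$, and on $s(v)$ otherwise. *Backup structure.* A comparison tree that answers range counting over $S$ with at most $\kappa(\lceil\log n\rceil+1)$ comparisons for every query. *Query.* (1) Descend to the node $v$ with $q\in s(v)$, comparing $q$ to the sides of the strips. If $v$ is a bad leaf, use the backup structure and stop. (2) Let $u$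 be the left child of $v$, or $u=v$ if $v$ is a leaf; locate $q_x$ and $q_y$ in the lists stored at $u$ with their search trees. (3) Walk from $u$ to the root, at each step locating $q_x$ and $q_y$ in the lists of the parent by following the tables and then scanning, and add up the numbers of catalogue points in the query range. Every comparison and every table access takes one step, as does reporting the answer; $\mu_D(T)$ is the expected number of steps for a query drawn from $D$. **Theorem.** For all sufficiently large $\kappa$ and all $\rho\ge1$, every finite non-empty $S\subset\mathbb R^2$ and every Borel probability measure $D$ on $\mathbb R^2$ have a biased range tree. Moreover, for all $\kappa\ge 0$ and $\rho\ge 1$ there is a constant $c>0$, depending only on $\kappa$ and $\rho$, such that for every finite non-empty $S\subset\mathbb R^2$, every Borel probability measure $D$ on $\mathbb R^2$ and every biased range tree $T$ for $(S,D)$: $T$ answers every 2-sided range counting query over $S$ correctly, and $$\mu_D(T^*)\ \ge\ c\,\mu_D(T)$$ for every comparison tree $T^*$ that answers range counting over $S$; that is, $\mu_D(T^*)=\Omega(\mu_D(T))$. -/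

import Mathlib

open MeasureTheory
open scoped NNReal ENNReal

/-- The two coordinates of the plane. -/
inductive Axis where
  | x : Axis
  | y : Axis

/-- The other coordinate. -/
def Axis.other : Axis → Axis
  | .x => .y
  | .y => .x

/-- The coordinate `q_x` or `q_y` of a point `q`. -/
def Axis.coord : Axis → ℝ × ℝ → ℝ
  | .x, q => q.1
  | .y, q => q.2

/-- The answer `|R(q) ∩ S|` of the 2-sided range counting query `q = (q_x, q_y)` over `S`. -/
noncomputable def rangeCount (S : Finset (ℝ × ℝ)) (q : ℝ × ℝ) : ℕ :=
  (S.filter fun p => q.1 ≤ p.1 ∧ q.2 ≤ p.2).card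

/-! ### Comparison trees -/

/-- Comparison trees: every internal node compares one coordinate of the query point to a fixed
value (`q_a < c` if `strict`, and `q_a ≤ c` otherwise); every leaf carries an answer. -/
inductive ComparisonTree where
  | leaf (label : ℕ) : ComparisonTree
  | node (a : Axis) (c : ℝ) (strict : Bool) (yes no : ComparisonTree) : ComparisonTree

namespace ComparisonTree

/-- The outcome of the comparison at a node. -/
def Test (a : Axis) (c : ℝ) (strict : Bool) (q : ℝ × ℝ) : Prop :=
  if strict then a.coord q < c else a.coord q ≤ c

open Classical in
/-- The label of the leaf at the end of the search path of `q`. -/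
noncomputable def eval : ComparisonTree → ℝ × ℝ → ℕ
  | leaf label, _ => label
  | node a c strict yes no, q => if Test a c strict q then yes.eval q else no.eval q

open Classical in
/-- The length of the search path of `q`, i.e. the number of comparisons. -/
noncomputable def depth : ComparisonTree → ℝ × ℝ → ℕ
  | leaf _, _ => 0
  | node a c strict yes no, q =>
      (if Test a c strict q then yes.depth q else no.depth q) + 1

/-- The tree answers all 2-sided range counting queries over `S`. -/
def Solves (t : ComparisonTree) (S : Finset (ℝ × ℝ)) : Prop :=
  ∀ q, t.eval q = rangeCount S q

/-- The expected search time `μ_D(t)`. -/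
noncomputable def expectedTime (D : Measure (ℝ × ℝ)) (t : ComparisonTree) : ℝ≥0∞ :=
  ∫⁻ q, (t.depth q : ℝ≥0∞) ∂D

end ComparisonTree

/-! ### One-dimensional biased search trees -/

/-- The number of entries of `L` that are smaller than `z`. For a sorted list, this says which of
the intervals `(x_i, x_{i+1}]` cut out by `L` contains `z`. -/
noncomputable def rank (L : List ℝ) (z : ℝ) : ℕ :=
  L.countP fun x => decide (x < z)

/-- One-dimensional search trees; a leaf names an interval. -/
inductive SearchTree where
  | leaf (i : ℕ) : SearchTree
  | node (key : ℝ) (left right : SearchTree) : SearchTree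

namespace SearchTree

/-- The interval found by searching for `z`. -/
noncomputable def find : SearchTree → ℝ → ℕ
  | leaf i, _ => i
  | node key l r, z => if z ≤ key then l.find z else r.find z

/-- The number of comparisons made when searching for `z`. -/
noncomputable def depth : SearchTree → ℝ → ℕ
  | leaf _, _ => 0
  | node key l r, z => (if z ≤ key then l.depth z else r.depth z) + 1

end SearchTree

/-- The entropy `∑ p_i log₂ (1 / p_i)`, where `p_i` is the probability that the coordinate `a` of a
point drawn from `P` lies in the `i`-th interval cut out by `L`. -/
noncomputable def intervalEntropy (P : Measure (ℝ × ℝ)) (a : Axis) (L : List ℝ) : ℝ :=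
  ∑ i ∈ Finset.range (L.length + 1),
    Real.negMulLog (P.real {q | rank L (a.coord q) = i}) / Real.log 2

/-- `t` is a biased search tree for the sorted list `L` and the distribution of the coordinate `a`
of a point drawn from `P`: it finds the interval containing any given value, with an expected number
of comparisons of at most the entropy plus a constant `κ`. -/
structure IsBiasedSearchTree (κ : ℕ) (P : Measure (ℝ × ℝ)) (a : Axis) (L : List ℝ)
    (t : SearchTree) : Prop where
  find_eq : ∀ z, t.find z = rank L z
  cost_le : ∫⁻ q, (t.depth (a.coord q) : ℝ≥0∞) ∂P ≤ ENNReal.ofReal (intervalEntropy P a L + κ)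

/-! ### The data stored in a biased range tree -/

/-- What a node stores for one of its two catalogues: the sorted list of coordinates of the catalogue
after fractional cascading; two tables indexed by the intervals of this list; and a search tree over
this list. For a value `z` in the `i`-th interval, `count i` is the number of points of the original
catalogue with coordinate at least `z`, and `bridge i` is the position in the corresponding list of
the parent at which to start looking for `z`. -/
structure Catalogue where
  stored : List ℝ
  count : ℕ → ℕ
  bridge : ℕ → ℕ
  index : SearchTree

/-- Primary trees. The strip of an internal node consists of the points of its region whose
coordinate `a` is in `(lo, hi]`; `lo = ⊥` and `hi = ⊤` are allowed. The catalogues `C_x`, `C_y` of a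
node are `cat .x`, `cat .y`. A leaf is marked as bad or not bad. -/
inductive PrimaryTree where
  | leaf (bad : Bool) (cat : Axis → Catalogue) : PrimaryTree
  | node (a : Axis) (lo hi : EReal) (cat : Axis → Catalogue) (left right : PrimaryTree) :
      PrimaryTree

/-- The catalogues of the root. -/
def PrimaryTree.cat : PrimaryTree → Axis → Catalogue
  | .leaf _ cat => cat
  | .node _ _ _ cat _ _ => cat

/-- A biased range tree consists of a primary tree with catalogues and of a backup structure. -/
structure BiasedRangeTree where
  primary : PrimaryTree
  backup : ComparisonTree

/-! ### The query algorithm, with its number of steps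

A comparison, and the reading of a table entry together with the arithmetic done on it, take one
step each. -/

/-- The state of a query: either a bad leaf was reached after `steps` steps, or `q` has been located
in the catalogues of the current node (`pos`), the points counted so far are `total`, and `steps`
steps have been made. -/
inductive Outcome where
  | bad (steps : ℕ) : Outcome
  | good (pos : Axis → ℕ) (total steps : ℕ) : Outcome

/-- Spend `k` more steps. -/
def Outcome.tick (k : ℕ) : Outcome → Outcome
  | .bad s => .bad (s + k)
  | .good pos total s => .good pos total (s + k)

/-- Step 2: locate `q` in the two catalogues of the node `u` by means of their search trees, and
count. -/
noncomputable def enter (u : Axis → Catalogue) (q : ℝ × ℝ) : Outcome :=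
  let pos : Axis → ℕ := fun a => (u a).index.find (a.coord q)
  let cost : Axis → ℕ := fun a => (u a).index.depth (a.coord q) + 1
  .good pos ((u .x).count (pos .x) + (u .y).count (pos .y)) (cost .x + cost .y)

/-- The number of entries skipped when the sorted list `L` is scanned for `z`, starting from the
position `k` and stopping at the first entry that is at least `z`. -/
noncomputable def scan (L : List ℝ) (z : ℝ) (k : ℕ) : ℕ :=
  ((L.drop k).takeWhile fun x => decide (x < z)).length

/-- One move of Step 3: go from the node `u` to its parent `w`, locate `q` in the catalogues of `w`
by following the bridges and scanning from there, and count. -/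
noncomputable def climb (u w : Axis → Catalogue) (q : ℝ × ℝ) : Outcome → Outcome
  | .bad s => .bad s
  | .good pos total s =>
    let start : Axis → ℕ := fun a => (u a).bridge (pos a)
    let skip : Axis → ℕ := fun a => scan (w a).stored (a.coord q) (start a)
    let pos' : Axis → ℕ := fun a => start a + skip a
    -- following the bridge, the comparisons of the scan, reading the count
    let cost : Axis → ℕ := fun a => 1 + (skip a + 1) + 1
    .good pos' (total + ((w .x).count (pos' .x) + (w .y).count (pos' .y)))
      (s + (cost .x + cost .y))

/-- Steps 1-3 on a subtree. Step 1 descends to the node `v` with `q ∈ s(v)`; if `v` is not a bad leaf,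
Step 2 is run at `u`, which is the left child of `v`, or `v` itself if `v` is a leaf; Step 3, run on
the way back, climbs from `u` to the root of the subtree. -/
noncomputable def PrimaryTree.visit : PrimaryTree → ℝ × ℝ → Outcome
  | .leaf bad cat, q => if bad then .bad 0 else enter cat q
  | .node a lo hi cat left right, q =>
    if hi < (a.coord q : EReal) then
      (climb right.cat cat q (right.visit q)).tick 1
    else if (a.coord q : EReal) ≤ lo then
      (climb left.cat cat q (left.visit q)).tick 2
    else
      (climb left.cat cat q (enter left.cat q)).tick 2

namespace BiasedRangeTree

/-- The answer to the query `q`. At a bad leaf, it comes from the backup structure. -/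
noncomputable def answer (T : BiasedRangeTree) (q : ℝ × ℝ) : ℕ :=
  match T.primary.visit q with
  | .bad _ => T.backup.eval q
  | .good _ total _ => total

/-- The number of steps made to answer the query `q`, including one for reporting the answer. -/
noncomputable def time (T : BiasedRangeTree) (q : ℝ × ℝ) : ℕ :=
  match T.primary.visit q with
  | .bad s => s + T.backup.depth q + 1
  | .good _ _ s => s + 1

/-- The expected query time `μ_D(T)`. -/
noncomputable def expectedTime (D : Measure (ℝ × ℝ)) (T : BiasedRangeTree) : ℝ≥0∞ :=
  ∫⁻ q, (T.time q : ℝ≥0∞) ∂D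

end BiasedRangeTree

/-! ### The biased range tree of a point set and a distribution -/

/-- The fraction of a list that is cascaded: every `ρ`-th entry. -/
def sample (ρ : ℕ) (L : List ℝ) : List ℝ :=
  (List.range (L.length / ρ)).filterMap fun j => L[ρ * (j + 1) - 1]?

/-- `C` is the `a`-catalogue for the set `own` of points, into which every `ρ`-th entry of the list
`parent` is cascaded, indexed by a biased search tree for the distribution `P`. -/
structure IsCatalogue (κ ρ : ℕ) (P : Measure (ℝ × ℝ)) (a : Axis) (own : Finset (ℝ × ℝ))
    (parent : List ℝ) (C : Catalogue) : Prop where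
  sorted : C.stored.Pairwise (· ≤ ·)
  content : (C.stored : Multiset ℝ) = own.val.map a.coord + (sample ρ parent : Multiset ℝ)
  count_eq : ∀ z, C.count (rank C.stored z) = (own.filter fun p => z ≤ a.coord p).card
  bridge_eq : ∀ z, C.bridge (rank C.stored z) = ρ * rank (sample ρ parent) z
  index_biased : IsBiasedSearchTree κ P a C.stored C.index

/-- Nodes of even depth are vertical (they are split by a vertical strip, that is, by
`x`-coordinates), nodes of odd depth are horizontal. -/
def axisAt (depth : ℕ) : Axis := if Even depth then .x else .y

/-- The part of the region `r` before the strip `(lo, hi]`. -/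
def leftPart (r : Set (ℝ × ℝ)) (a : Axis) (lo : EReal) : Set (ℝ × ℝ) :=
  {q | q ∈ r ∧ (a.coord q : EReal) ≤ lo}

/-- The strip `(lo, hi]` of the region `r`. -/
def stripPart (r : Set (ℝ × ℝ)) (a : Axis) (lo hi : EReal) : Set (ℝ × ℝ) :=
  {q | q ∈ r ∧ lo < (a.coord q : EReal) ∧ (a.coord q : EReal) ≤ hi}

/-- The part of the region `r` after the strip `(lo, hi]`. -/
def rightPart (r : Set (ℝ × ℝ)) (a : Axis) (hi : EReal) : Set (ℝ × ℝ) :=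
  {q | q ∈ r ∧ hi < (a.coord q : EReal)}

/-- `(lo, hi]` is the strip selected at a node with region `r`: it is one of the strips into which
`r` is cut by the lines through the points of `S` in `r`, and neither side of it has more than half
of the probability of `r`. Among the strips with this property, the one for which the right side has
less than half is taken; it is unique if `r` has positive probability. -/
structure IsSplitStrip (S : Finset (ℝ × ℝ)) (D : Measure (ℝ × ℝ)) (r : Set (ℝ × ℝ)) (a : Axis)
    (lo hi : EReal) : Prop where
  lo_mem : lo = ⊥ ∨ ∃ p ∈ S, p ∈ r ∧ lo = (a.coord p : EReal)
  hi_mem : hi = ⊤ ∨ ∃ p ∈ S, p ∈ r ∧ hi = (a.coord p : EReal)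
  lo_lt_hi : lo < hi
  consecutive : ∀ p ∈ S, p ∈ r → (a.coord p : EReal) ≤ lo ∨ hi ≤ (a.coord p : EReal)
  left_le : D (leftPart r a lo) ≤ D r / 2
  right_le : D (rightPart r a hi) ≤ D r / 2
  right_lt : D r ≠ 0 → D (rightPart r a hi) < D r / 2

/-- A node of the given depth with region `r` is split. -/
def IsSplit (S : Finset (ℝ × ℝ)) (depth : ℕ) (r : Set (ℝ × ℝ)) : Prop :=
  depth < Nat.clog 2 S.card ∧ ∃ p ∈ S, p ∈ r

open Classical in
/-- The sets of points in the two catalogues (before cascading) of the left child of a node that is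
split along the axis `a`: the points in the strip or in the right part go into the catalogue for the
other axis, and the other catalogue is empty. -/
noncomputable def leftOwn (S : Finset (ℝ × ℝ)) (r : Set (ℝ × ℝ)) (a : Axis) (lo hi : EReal) :
    Axis → Finset (ℝ × ℝ) := fun b =>
  if b = a.other then S.filter fun p => p ∈ stripPart r a lo hi ∪ rightPart r a hi else ∅

/-- The tree is the part of the primary tree of a biased range tree for `(S, D)` below a node `v` with
the given depth and region `r`, where `own` are the sets of points in the catalogues of `v` before
cascading, and `up` are the lists stored in the catalogues of its parent. If `v` is a left child,
then `W` is the strip of its parent, and the search trees at `v` are biased according to the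
distribution `D` conditioned on `W`; otherwise, `W` is `none`, and `D` is conditioned on the strip
of `v`, which is `r` if `v` is a leaf. -/
def PrimaryTree.IsFor (κ ρ : ℕ) (S : Finset (ℝ × ℝ)) (D : Measure (ℝ × ℝ)) :
    PrimaryTree → (depth : ℕ) → (r : Set (ℝ × ℝ)) → (own : Axis → Finset (ℝ × ℝ)) →
      (up : Axis → List ℝ) → (W : Option (Set (ℝ × ℝ))) → Prop
  | .leaf bad cat, depth, r, own, up, W =>
      ¬ IsSplit S depth r ∧
      (bad = true ↔ ∃ p ∈ S, p ∈ r) ∧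
      ∀ b, IsCatalogue κ ρ (ProbabilityTheory.cond D (W.getD r)) b (own b) (up b) (cat b)
  | .node a lo hi cat left right, depth, r, own, up, W =>
      IsSplit S depth r ∧
      a = axisAt depth ∧
      IsSplitStrip S D r a lo hi ∧
      (∀ b, IsCatalogue κ ρ (ProbabilityTheory.cond D (W.getD (stripPart r a lo hi))) b
        (own b) (up b) (cat b)) ∧
      left.IsFor κ ρ S D (depth + 1) (leftPart r a lo) (leftOwn S r a lo hi)
        (fun b => (cat b).stored) (some (stripPart r a lo hi)) ∧
      right.IsFor κ ρ S D (depth + 1) (rightPart r a hi) (fun _ => ∅)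
        (fun b => (cat b).stored) none

/-- `T` is a biased range tree for the point set `S` and the distribution `D`, where fractional
cascading passes on every `ρ`-th entry, and where the constant `κ` bounds the overhead of the biased
search trees and the constant factor in the `O(log n)` worst-case time of the backup structure. -/
structure IsBiasedRangeTree (κ ρ : ℕ) (S : Finset (ℝ × ℝ)) (D : Measure (ℝ × ℝ))
    (T : BiasedRangeTree) : Prop where
  primary : T.primary.IsFor κ ρ S D 0 Set.univ (fun _ => ∅) (fun _ => []) none
  backup_solves : T.backup.Solves S
  backup_depth : ∀ q, T.backup.depth q ≤ κ * (Nat.clog 2 S.card + 1)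

/-! Correctness is an invariant of the climb: at a node with region `r`, the running total counts
the points of `r` in the query range and the points of the node's own catalogues that pass a test of
one coordinate. One coordinate is enough because the catalogue points lie beyond the region along
the other axis (`IsFor.visit_spec`).

The query time is at most a constant times (level + 1) plus the cost of two searches, where the
level is the depth at which the descent stops. A bad leaf has depth at least ⌈log n⌉, which pays for
the backup structure. Both terms are compared with an arbitrary comparison tree `T*`. The queries
reaching a leaf of `T*` form a product of intervals, hence a sublattice `R` of the plane, and the
answer is constant on `R`. This forces every point of `S` to be in the range of all queries of `R`
or of none (`homogeneous_of_rangeCount_eq`).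

Level: if `R` reaches as low as the region `r` along the axis that is not cut, then `R` cannot meet
both sides of the strip. Once `R` has met a left part, this applies at every second level below the
right sibling. There `R` branches at most at every other level, while probabilities halve at every
level. Hence the integral of (5/4)^level over `R` is at most 17 (`IsFor.setLIntegral_weight_le`). A
Kraft inequality over the leaves of `T*` bounds the mean of 2^(-depth) (5/4)^level by 17, and so the
mean level by 4 μ(`T*`) + 68.

Searches: inside a stopping strip, the leaf of `T*` determines the interval found, so conditioned on
the strip the mean depth of `T*` is at least the entropy of the interval
(`ComparisonTree.sum_negMulLog_le`). Adding over the disjoint strips, and over two coordinates,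
bounds the search cost by 2 (μ(`T*`) + κ). Additive constants are absorbed because μ(`T*`) ≥ 1.

For existence, the only quantitative point is a search tree with overhead 3, obtained by repeated
bisection of the unit interval. -/

/-! ### Ranks in sorted lists -/

theorem rank_cons (x : ℝ) (L : List ℝ) (z : ℝ) :
    rank (x :: L) z = rank L z + if x < z then 1 else 0 := by
  simp [rank, List.countP_cons]

theorem rank_le_length (L : List ℝ) (z : ℝ) : rank L z ≤ L.length := List.countP_le_length

theorem rank_mono (L : List ℝ) : Monotone (rank L) := fun y z h =>
  List.countP_mono_left fun x _ hx => by
    simp only [decide_eq_true_eq] at hx ⊢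
    exact hx.trans_le h

/-- This makes tables indexed by ranks well defined: the rank alone decides which entries lie before
the value. -/
theorem lt_iff_lt_of_rank_eq {L : List ℝ} {y z : ℝ} (h : rank L y = rank L z) :
    ∀ x ∈ L, x < y ↔ x < z := by
  wlog hyz : y ≤ z generalizing y z
  · exact fun x hx => (this h.symm (le_of_not_ge hyz) x hx).symm
  induction L with
  | nil => simp
  | cons x L ih =>
    rw [rank_cons, rank_cons] at h
    have h1 := rank_mono L hyz
    have h2 : x < y → x < z := fun h => h.trans_le hyz
    have h3 : rank L y = rank L z ∧ (x < y ↔ x < z) := by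
      by_cases hy : x < y
      · have hz := h2 hy
        simp only [hy, hz, if_true] at h
        exact ⟨by omega, by simp [hy, hz]⟩
      · by_cases hz : x < z
        · simp only [hy, hz, if_true, if_false] at h
          omega
        · simp only [hy, hz, if_false] at h
          exact ⟨by omega, by simp [hy, hz]⟩
    intro w hw
    rcases List.mem_cons.1 hw with rfl | hw
    · exact h3.2
    · exact ih h3.1 w hw

theorem measurable_rank (L : List ℝ) : Measurable (rank L) := (rank_mono L).measurable

theorem getElem_lt_iff_lt_rank {L : List ℝ} (hL : L.Pairwise (· ≤ ·)) (z : ℝ) :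
    ∀ (i : ℕ) (hi : i < L.length), L[i] < z ↔ i < rank L z := by
  induction L with
  | nil => simp
  | cons x L ih =>
    intro i hi
    rw [List.pairwise_cons] at hL
    rw [rank_cons]
    by_cases hx : x < z
    · cases i with
      | zero => simp [hx]
      | succ i => simpa [hx] using ih hL.2 i (by simpa using hi)
    · have h0 : rank L z = 0 := by
        simp only [rank, List.countP_eq_zero, decide_eq_true_eq]
        exact fun w hw h => hx ((hL.1 w hw).trans_lt h)
      have h1 : x ≤ (x :: L)[i] := by
        cases i with
        | zero => simp
        | succ i => simpa using hL.1 _ (List.getElem_mem _)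
      simp only [h0, hx, if_false, add_zero, not_lt_zero, iff_false]
      exact fun h => hx (h1.trans_lt h)

theorem rank_eq_length_takeWhile {L : List ℝ} (hL : L.Pairwise (· ≤ ·)) (z : ℝ) :
    (L.takeWhile fun x => decide (x < z)).length = rank L z := by
  induction L with
  | nil => simp [rank]
  | cons x L ih =>
    rw [List.pairwise_cons] at hL
    rw [rank_cons]
    by_cases hx : x < z
    · simp [hx, ih hL.2]
    · have h0 : rank L z = 0 := by
        simp only [rank, List.countP_eq_zero, decide_eq_true_eq]
        exact fun w hw h => hx ((hL.1 w hw).trans_lt h)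
      simp [hx, h0]

theorem scan_eq {L : List ℝ} (hL : L.Pairwise (· ≤ ·)) {z : ℝ} {k : ℕ} (hk : k ≤ rank L z) :
    scan L z k = rank L z - k := by
  rw [scan, rank_eq_length_takeWhile (hL.drop)]
  have h1 : rank L z = rank (L.take k) z + rank (L.drop k) z := by
    conv_lhs => rw [← List.take_append_drop k L]
    simp only [rank, List.countP_append]
  have hlen : (L.take k).length = k := by
    have := rank_le_length L z
    simp
    omega
  have h2 : rank (L.take k) z = k := by
    conv_rhs => rw [← hlen]
    rw [rank, List.countP_eq_length]
    intro x hx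
    obtain ⟨i, hi, rfl⟩ := List.getElem_of_mem hx
    rw [decide_eq_true_eq, List.getElem_take, getElem_lt_iff_lt_rank hL]
    omega
  omega

theorem countP_range_lt (m k : ℕ) :
    (List.range m).countP (fun j => decide (j < k)) = min m k := by
  induction m with
  | zero => simp
  | succ m ih =>
    rw [List.range_succ, List.countP_append, ih]
    by_cases h : m < k <;> simp [h] <;> omega

/-- The sampled entry number `j` has index ρ(j+1)-1 in `L`, so it is smaller than `z` exactly when
ρ(j+1) ≤ `rank L z`. -/
theorem rank_sample {L : List ℝ} (hL : L.Pairwise (· ≤ ·)) {ρ : ℕ} (hρ : 1 ≤ ρ) (z : ℝ) :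
    rank (sample ρ L) z = rank L z / ρ := by
  rw [rank, sample, List.countP_filterMap]
  have key : ∀ j ∈ List.range (L.length / ρ),
      (((L[ρ * (j + 1) - 1]?).map fun x => decide (x < z)).getD false = true ↔
        decide (j < rank L z / ρ) = true) := by
    intro j hj
    rw [List.mem_range, Nat.lt_iff_add_one_le, Nat.le_div_iff_mul_le hρ, mul_comm] at hj
    have h1 : 1 ≤ ρ * (j + 1) := Nat.mul_pos hρ (Nat.succ_pos j)
    have h2 : ρ * (j + 1) - 1 < L.length := by omega
    rw [List.getElem?_eq_getElem h2]
    simp only [Option.map_some, Option.getD_some, decide_eq_true_eq]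
    rw [getElem_lt_iff_lt_rank hL, Nat.lt_iff_add_one_le (m := j), Nat.le_div_iff_mul_le hρ,
      mul_comm (j + 1)]
    omega
  rw [List.countP_congr key, countP_range_lt]
  exact min_eq_right (Nat.div_le_div_right (rank_le_length L z))

theorem mem_of_mem_sample {ρ : ℕ} {L : List ℝ} {x : ℝ} (h : x ∈ sample ρ L) : x ∈ L := by
  rw [sample, List.mem_filterMap] at h
  obtain ⟨j, _, hj⟩ := h
  exact List.mem_of_getElem? hj

/-! ### Coordinates -/

theorem Axis.other_other (a : Axis) : a.other.other = a := by cases a <;> rfl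

theorem axisAt_succ (d : ℕ) : axisAt (d + 1) = (axisAt d).other := by
  by_cases h : Even d
  · simp [axisAt, h, Nat.even_add_one, Axis.other]
  · simp [axisAt, h, Nat.even_add_one, Axis.other]

theorem Axis.measurable_coord (a : Axis) : Measurable a.coord := by
  cases a
  · exact measurable_fst
  · exact measurable_snd

theorem le_iff_coord (a : Axis) (q p : ℝ × ℝ) :
    q ≤ p ↔ a.coord q ≤ a.coord p ∧ a.other.coord q ≤ a.other.coord p := by
  cases a
  · exact Iff.rfl
  · exact Prod.le_def.trans and_comm

theorem rangeCount_eq (S : Finset (ℝ × ℝ)) (q : ℝ × ℝ) :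
    rangeCount S q = (S.filter fun p => q ≤ p).card := rfl

/-! ### The search path of a query in the primary tree -/

/-- The depth of the node at which Step 1 stops, relative to the root of the tree. -/
noncomputable def PrimaryTree.level : PrimaryTree → ℝ × ℝ → ℕ
  | .leaf _ _, _ => 0
  | .node a lo hi _ left right, q =>
    if hi < (a.coord q : EReal) then right.level q + 1
    else if (a.coord q : EReal) ≤ lo then left.level q + 1 else 0

/-- The number of comparisons made in the two search trees used in Step 2. -/
noncomputable def PrimaryTree.indexCost : PrimaryTree → ℝ × ℝ → ℕ
  | .leaf bad cat, q =>
    if bad then 0 else (cat .x).index.depth q.1 + (cat .y).index.depth q.2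
  | .node a lo hi _ left right, q =>
    if hi < (a.coord q : EReal) then right.indexCost q
    else if (a.coord q : EReal) ≤ lo then left.indexCost q
    else (left.cat .x).index.depth q.1 + (left.cat .y).index.depth q.2

namespace PrimaryTree

variable {κ ρ : ℕ} {S : Finset (ℝ × ℝ)} {D : Measure (ℝ × ℝ)}

theorem IsFor.isCatalogue_of_some {t : PrimaryTree} {d : ℕ} {r : Set (ℝ × ℝ)}
    {own : Axis → Finset (ℝ × ℝ)} {up : Axis → List ℝ} {W : Set (ℝ × ℝ)}
    (h : t.IsFor κ ρ S D d r own up (some W)) (b : Axis) :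
    IsCatalogue κ ρ (ProbabilityTheory.cond D W) b (own b) (up b) (t.cat b) := by
  cases t with
  | leaf bad cat => exact h.2.2 b
  | node a lo hi cat left right => exact h.2.2.2.1 b

theorem IsFor.exists_isCatalogue {t : PrimaryTree} {d : ℕ} {r : Set (ℝ × ℝ)}
    {own : Axis → Finset (ℝ × ℝ)} {up : Axis → List ℝ} {W : Option (Set (ℝ × ℝ))}
    (h : t.IsFor κ ρ S D d r own up W) (b : Axis) :
    ∃ P, IsCatalogue κ ρ P b (own b) (up b) (t.cat b) := by
  cases t with
  | leaf bad cat => exact ⟨_, h.2.2 b⟩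
  | node a lo hi cat left right => exact ⟨_, h.2.2.2.1 b⟩

end PrimaryTree

/-- The number of points counted in the catalogues of a node. -/
noncomputable def ownCount (own : Axis → Finset (ℝ × ℝ)) (q : ℝ × ℝ) : ℕ :=
  ((own .x).filter fun p => q.1 ≤ p.1).card + ((own .y).filter fun p => q.2 ≤ p.2).card

/-- The number of points in the query range that lie in `r`. -/
noncomputable def regionCount (S : Finset (ℝ × ℝ)) (r : Set (ℝ × ℝ)) (q : ℝ × ℝ) : ℕ :=
  open Classical in (S.filter fun p => p ∈ r ∧ q ≤ p).card

theorem ownCount_empty (q : ℝ × ℝ) : ownCount (fun _ => ∅) q = 0 := by simp [ownCount]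

theorem ownCount_leftOwn (S : Finset (ℝ × ℝ)) (r : Set (ℝ × ℝ)) (a : Axis) (lo hi : EReal)
    (q : ℝ × ℝ) :
    ownCount (leftOwn S r a lo hi) q = open Classical in
      (S.filter fun p => p ∈ stripPart r a lo hi ∪ rightPart r a hi ∧
        a.other.coord q ≤ a.other.coord p).card := by
  cases a <;> simp [ownCount, leftOwn, Axis.other, Finset.filter_filter, Axis.coord] <;> congr

theorem enter_eq {u : Axis → Catalogue} {own : Axis → Finset (ℝ × ℝ)} {up : Axis → List ℝ}
    {κ ρ : ℕ} (hu : ∀ b, ∃ P, IsCatalogue κ ρ P b (own b) (up b) (u b)) (q : ℝ × ℝ) :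
    enter u q = .good (fun b => rank (u b).stored (b.coord q)) (ownCount own q)
      ((u .x).index.depth q.1 + (u .y).index.depth q.2 + 2) := by
  have hfind : ∀ b : Axis, (u b).index.find (b.coord q) = rank (u b).stored (b.coord q) := by
    intro b
    obtain ⟨P, h⟩ := hu b
    exact h.index_biased.find_eq _
  obtain ⟨_, hx⟩ := hu .x
  obtain ⟨_, hy⟩ := hu .y
  rw [enter]
  simp only [hfind]
  congr 1
  · rw [hx.count_eq, hy.count_eq]
    rfl
  · simp only [Axis.coord]
    omega

/-- The bridge rounds the position in the parent's list down to a multiple of ρ, so a scan skips at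
most ρ-1 entries. With the bridge, the last comparison and the table access, each list costs at most
ρ+2 steps. -/
theorem climb_good {u w : Axis → Catalogue} {own own' : Axis → Finset (ℝ × ℝ)}
    {up : Axis → List ℝ} {κ ρ : ℕ} (hρ : 1 ≤ ρ)
    (hu : ∀ b, ∃ P, IsCatalogue κ ρ P b (own' b) (w b).stored (u b))
    (hw : ∀ b, ∃ P, IsCatalogue κ ρ P b (own b) (up b) (w b)) (q : ℝ × ℝ) (total s : ℕ) :
    ∃ s' ≤ s + (2 * ρ + 4),
      climb u w q (.good (fun b => rank (u b).stored (b.coord q)) total s) =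
        .good (fun b => rank (w b).stored (b.coord q)) (total + ownCount own q) s' := by
  have hstart : ∀ b : Axis, (u b).bridge (rank (u b).stored (b.coord q)) =
      ρ * (rank (w b).stored (b.coord q) / ρ) := by
    intro b
    obtain ⟨P, h⟩ := hu b
    obtain ⟨P', h'⟩ := hw b
    rw [h.bridge_eq, rank_sample h'.sorted hρ]
  have hskip : ∀ b : Axis, scan (w b).stored (b.coord q)
      (ρ * (rank (w b).stored (b.coord q) / ρ)) = rank (w b).stored (b.coord q) % ρ := by
    intro b
    obtain ⟨P', h'⟩ := hw b
    rw [scan_eq h'.sorted (Nat.mul_div_le _ _)]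
    have := Nat.div_add_mod (rank (w b).stored (b.coord q)) ρ
    omega
  obtain ⟨_, hx⟩ := hw .x
  obtain ⟨_, hy⟩ := hw .y
  simp only [climb, hstart, hskip, Nat.div_add_mod, hx.count_eq, hy.count_eq]
  refine ⟨_, ?_, rfl⟩
  have h1 := Nat.mod_lt (rank (w .x).stored (Axis.x.coord q)) hρ
  have h2 := Nat.mod_lt (rank (w .y).stored (Axis.y.coord q)) hρ
  omega

theorem IsSplitStrip.le_coord_of_lt {S : Finset (ℝ × ℝ)} {D : Measure (ℝ × ℝ)}
    {r : Set (ℝ × ℝ)} {a : Axis} {lo hi : EReal} (h : IsSplitStrip S D r a lo hi) {p : ℝ × ℝ}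
    (hp : p ∈ S) (hr : p ∈ r) (hlo : lo < (a.coord p : EReal)) : hi ≤ (a.coord p : EReal) :=
  (h.consecutive p hp hr).resolve_left hlo.not_ge

/-- For a query in the right part of a region, only points in the right part count. -/
theorem regionCount_rightPart {S : Finset (ℝ × ℝ)} {r : Set (ℝ × ℝ)} {a : Axis} {hi : EReal}
    {q : ℝ × ℝ} (hq : hi < (a.coord q : EReal)) :
    regionCount S (rightPart r a hi) q = regionCount S r q := by
  classical
  unfold regionCount
  congr 1
  ext p
  rw [Finset.mem_filter, Finset.mem_filter]
  refine and_congr_right fun _ => ⟨fun h => ⟨h.1.1, h.2⟩, fun h => ⟨⟨h.1, ?_⟩, h.2⟩⟩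
  exact hq.trans_le (EReal.coe_le_coe_iff.2 ((le_iff_coord a q p).1 h.2).1)

/-- For a query that is not in the right part of a region, the points that are not in the left part
are counted by the catalogues of the left child. -/
theorem regionCount_leftPart_add {S : Finset (ℝ × ℝ)} {D : Measure (ℝ × ℝ)} {r : Set (ℝ × ℝ)}
    {a : Axis} {lo hi : EReal} (h : IsSplitStrip S D r a lo hi) {q : ℝ × ℝ}
    (hq : (a.coord q : EReal) ≤ hi) :
    regionCount S (leftPart r a lo) q + ownCount (leftOwn S r a lo hi) q = regionCount S r q := by
  classical
  rw [ownCount_leftOwn]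
  unfold regionCount
  rw [← Finset.card_union_of_disjoint]
  · congr 1
    ext p
    rw [Finset.mem_union, Finset.mem_filter, Finset.mem_filter, Finset.mem_filter]
    simp only [Set.mem_union, leftPart, stripPart, rightPart,
      Set.mem_ofPred_eq, le_iff_coord a q p]
    constructor
    · rintro (⟨hS, hl, hle⟩ | ⟨hS, hr, hle⟩)
      · exact ⟨hS, hl.1, hle⟩
      · have hpr : p ∈ r := by rcases hr with hr | hr <;> exact hr.1
        have hlo : lo < (a.coord p : EReal) := by
          rcases hr with hr | hr
          · exact hr.2.1
          · exact h.lo_lt_hi.trans hr.2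
        -- The point is not before `hi` and the query is not after it, so the cut coordinate needs
        -- no test.
        exact ⟨hS, hpr, EReal.coe_le_coe_iff.1
          (hq.trans (IsSplitStrip.le_coord_of_lt h hS hpr hlo)), hle⟩
    · rintro ⟨hS, hr, hle⟩
      by_cases hlo : (a.coord p : EReal) ≤ lo
      · exact .inl ⟨hS, ⟨hr, hlo⟩, hle⟩
      · rw [not_le] at hlo
        by_cases hhi : (a.coord p : EReal) ≤ hi
        · exact .inr ⟨hS, .inl ⟨hr, hlo, hhi⟩, hle.2⟩
        · exact .inr ⟨hS, .inr ⟨hr, not_le.1 hhi⟩, hle.2⟩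
  · rw [Finset.disjoint_filter]
    rintro p hS hl ⟨hr | hr, _⟩
    · exact absurd hl.1.2 (not_le.2 hr.2.1)
    · exact absurd hl.1.2 (not_le.2 (h.lo_lt_hi.trans hr.2))

theorem regionCount_leftPart_of_lt {S : Finset (ℝ × ℝ)} {r : Set (ℝ × ℝ)} {a : Axis}
    {lo : EReal} {q : ℝ × ℝ} (hq : lo < (a.coord q : EReal)) :
    regionCount S (leftPart r a lo) q = 0 := by
  classical
  unfold regionCount
  rw [Finset.card_eq_zero, Finset.filter_eq_empty_iff]
  rintro p _ ⟨hl, hle⟩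
  exact absurd (hq.trans_le (EReal.coe_le_coe_iff.2 ((le_iff_coord a q p).1 hle).1))
    (not_lt.2 hl.2)

theorem regionCount_of_forall_notMem {S : Finset (ℝ × ℝ)} {r : Set (ℝ × ℝ)}
    (h : ¬ ∃ p ∈ S, p ∈ r) (q : ℝ × ℝ) : regionCount S r q = 0 := by
  classical
  unfold regionCount
  rw [Finset.card_eq_zero, Finset.filter_eq_empty_iff]
  exact fun p hS hp => h ⟨p, hS, hp.1⟩

namespace PrimaryTree

variable {κ ρ : ℕ} {S : Finset (ℝ × ℝ)} {D : Measure (ℝ × ℝ)}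

theorem cat_node (a : Axis) (lo hi : EReal) (cat : Axis → Catalogue) (left right : PrimaryTree) :
    (node a lo hi cat left right).cat = cat := rfl

/-- The outcome of a query on a subtree, and the number of steps made. -/
theorem IsFor.visit_spec (hρ : 1 ≤ ρ) {q : ℝ × ℝ} {t : PrimaryTree} :
    ∀ {d : ℕ} {r : Set (ℝ × ℝ)} {own : Axis → Finset (ℝ × ℝ)} {up : Axis → List ℝ}
      {W : Option (Set (ℝ × ℝ))}, t.IsFor κ ρ S D d r own up W → q ∈ r →
      (∃ s, t.visit q = .bad s ∧ s ≤ 2 * t.level q ∧ Nat.clog 2 S.card ≤ d + t.level q) ∨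
      ∃ s, t.visit q = .good (fun b => rank (t.cat b).stored (b.coord q))
          (regionCount S r q + ownCount own q) s ∧
        s ≤ (2 * ρ + 6) * (t.level q + 1) + t.indexCost q + 2 := by
  induction t with
  | leaf bad cat =>
    intro d r own up W h hq
    obtain ⟨hsplit, hbad, hcat⟩ := h
    cases bad with
    | true =>
      refine .inl ⟨0, by simp [visit], by simp, ?_⟩
      -- A leaf that still contains points was left unsplit only because its depth has reached ⌈log
      -- n⌉.
      simp only [true_iff] at hbad
      simp only [IsSplit, hbad, and_true, not_lt] at hsplit
      simpa [level] using hsplit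
    | false =>
      refine .inr ⟨(cat .x).index.depth q.1 + (cat .y).index.depth q.2 + 2, ?_, ?_⟩
      · simp only [visit, Bool.false_eq_true, if_false]
        rw [enter_eq (fun b => ⟨_, hcat b⟩)]
        rw [regionCount_of_forall_notMem (by simpa using hbad), zero_add]
        rfl
      · simp [level, indexCost]
  | node a lo hi cat left right ihl ihr =>
    intro d r own up W h hq
    obtain ⟨hsplit, ha, hstrip, hcat, hleft, hright⟩ := h
    have hcat' : ∀ b, ∃ P, IsCatalogue κ ρ P b (own b) (up b) (cat b) := fun b => ⟨_, hcat b⟩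
    by_cases h1 : hi < (a.coord q : EReal)
    · simp only [visit, level, indexCost, h1, if_true, cat_node]
      rcases ihr hright ⟨hq, h1⟩ with ⟨s, hs, hle, hc⟩ | ⟨s, hs, hle⟩
      · refine .inl ⟨s + 1, by rw [hs]; rfl, by omega, by omega⟩
      · obtain ⟨s', hs', he⟩ := climb_good hρ hright.exists_isCatalogue hcat' q
          (regionCount S (rightPart r a hi) q + ownCount (fun _ => ∅) q) s
        refine .inr ⟨s' + 1, ?_, by linarith⟩
        rw [hs, he, ownCount_empty, regionCount_rightPart h1, add_zero]
        rfl
    · have h1' := not_lt.1 h1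
      by_cases h2 : (a.coord q : EReal) ≤ lo
      · simp only [visit, level, indexCost, h1, h2, if_true, if_false, cat_node]
        rcases ihl hleft ⟨hq, h2⟩ with ⟨s, hs, hle, hc⟩ | ⟨s, hs, hle⟩
        · refine .inl ⟨s + 2, by rw [hs]; rfl, by omega, by omega⟩
        · obtain ⟨s', hs', he⟩ := climb_good hρ hleft.exists_isCatalogue hcat' q
            (regionCount S (leftPart r a lo) q + ownCount (leftOwn S r a lo hi) q) s
          refine .inr ⟨s' + 2, ?_, by linarith⟩
          rw [hs, he, regionCount_leftPart_add hstrip h1']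
          rfl
      · simp only [visit, level, indexCost, h1, h2, if_false, cat_node]
        -- The descent stops here, but the climb starts one level lower, at the left child, whose
        -- catalogues hold the points of the strip and of the right part. Hence the `level + 1` in
        -- the bound.
        rw [enter_eq hleft.exists_isCatalogue]
        obtain ⟨s', hs', he⟩ := climb_good hρ hleft.exists_isCatalogue hcat' q
          (ownCount (leftOwn S r a lo hi) q)
          ((left.cat .x).index.depth q.1 + (left.cat .y).index.depth q.2 + 2)
        refine .inr ⟨s' + 2, ?_, by omega⟩
        rw [he, ← regionCount_leftPart_add hstrip h1',
          regionCount_leftPart_of_lt (not_le.1 h2), zero_add]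
        rfl

end PrimaryTree

namespace IsBiasedRangeTree

variable {κ ρ : ℕ} {S : Finset (ℝ × ℝ)} {D : Measure (ℝ × ℝ)} {T : BiasedRangeTree}

theorem answer_eq (h : IsBiasedRangeTree κ ρ S D T) (hρ : 1 ≤ ρ) (q : ℝ × ℝ) :
    T.answer q = rangeCount S q := by
  rcases h.primary.visit_spec hρ (Set.mem_univ q) with ⟨s, hs, -, -⟩ | ⟨s, hs, -⟩
  · rw [BiasedRangeTree.answer, hs]
    exact h.backup_solves q
  · rw [BiasedRangeTree.answer, hs]
    simp [ownCount_empty, regionCount, rangeCount_eq]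

/-- The query time is bounded in terms of the depth of the node reached in Step 1 and of the number
of comparisons made in the search trees. -/
theorem time_le (h : IsBiasedRangeTree κ ρ S D T) (hρ : 1 ≤ ρ) (q : ℝ × ℝ) :
    T.time q ≤ (2 * ρ + κ + 9) * (T.primary.level q + 1) + T.primary.indexCost q := by
  rcases h.primary.visit_spec hρ (Set.mem_univ q) with ⟨s, hs, hle, hc⟩ | ⟨s, hs, hle⟩
  · rw [BiasedRangeTree.time, hs]
    have h1 : T.backup.depth q ≤ κ * (T.primary.level q + 1) :=
      (h.backup_depth q).trans (Nat.mul_le_mul_left _ (by omega))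
    simp only
    nlinarith [Nat.zero_le (ρ * (T.primary.level q + 1))]
  · rw [BiasedRangeTree.time, hs]
    simp only
    nlinarith [Nat.zero_le (κ * (T.primary.level q + 1))]

end IsBiasedRangeTree

/-! ### Sets of queries on which the answer is constant -/

/-- Every point is either in the range of all queries in `A` or in the range of none of them. -/
def Homogeneous (S : Finset (ℝ × ℝ)) (A : Set (ℝ × ℝ)) : Prop :=
  ∀ p ∈ S, (∃ q ∈ A, q ≤ p) → ∀ q ∈ A, q ≤ p

/-- If `p` is in the range of `q` but not of `q'`, then the range of `q ⊔ q'` is contained in that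
of `q` and misses `p`. The counts of two queries in `A` would then differ. -/
theorem homogeneous_of_rangeCount_eq {S : Finset (ℝ × ℝ)} {A : Set (ℝ × ℝ)}
    (hA : IsSublattice A) {n : ℕ} (h : ∀ q ∈ A, rangeCount S q = n) : Homogeneous S A := by
  rintro p hp ⟨q, hq, hqp⟩ q' hq'
  by_contra hn
  have h1 := h _ hq
  have h2 := h _ (hA.supClosed hq hq')
  rw [rangeCount_eq] at h1 h2
  have hlt : (S.filter fun p => q ⊔ q' ≤ p).card < (S.filter fun p => q ≤ p).card := by
    refine Finset.card_lt_card (Finset.ssubset_iff_of_subset ?_ |>.2 ⟨p, ?_, ?_⟩)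
    · exact Finset.monotone_filter_right _ fun x _ hx => le_sup_left.trans hx
    · exact Finset.mem_filter.2 ⟨hp, hqp⟩
    · exact fun hm => hn (le_sup_right.trans (Finset.mem_filter.1 hm).2)
  omega

namespace Axis

theorem coord_sup (a : Axis) (q q' : ℝ × ℝ) : a.coord (q ⊔ q') = a.coord q ⊔ a.coord q' := by
  cases a <;> rfl

theorem coord_inf (a : Axis) (q q' : ℝ × ℝ) : a.coord (q ⊓ q') = a.coord q ⊓ a.coord q' := by
  cases a <;> rfl

theorem isSublattice_preimage_coord (a : Axis) (I : Set ℝ) : IsSublattice (a.coord ⁻¹' I) := by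
  constructor
  · intro q hq q' hq'
    rw [Set.mem_preimage, coord_sup]
    rcases max_choice (a.coord q) (a.coord q') with h | h <;> rw [h] <;> assumption
  · intro q hq q' hq'
    rw [Set.mem_preimage, coord_inf]
    rcases min_choice (a.coord q) (a.coord q') with h | h <;> rw [h] <;> assumption

end Axis

namespace ComparisonTree

theorem exists_setOf_test_eq (a : Axis) (c : ℝ) (s : Bool) :
    ∃ I : Set ℝ, MeasurableSet I ∧ ∀ q, Test a c s q ↔ q ∈ a.coord ⁻¹' I := by
  cases s
  · exact ⟨Set.Iic c, measurableSet_Iic, fun q => by simp [Test]⟩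
  · exact ⟨Set.Iio c, measurableSet_Iio, fun q => by simp [Test]⟩

/-- Induction along the sets of queries that reach the nodes of a tree that answers range counting. -/
theorem induction_on_sets {S : Finset (ℝ × ℝ)} {motive : ComparisonTree → Set (ℝ × ℝ) → Prop}
    (leaf : ∀ n A, MeasurableSet A → IsSublattice A → Homogeneous S A → motive (.leaf n) A)
    (node : ∀ (t yes no : ComparisonTree) (A B : Set (ℝ × ℝ)), MeasurableSet A → MeasurableSet B →
      (∀ q ∈ B, t.depth q = yes.depth q + 1) → (∀ q ∉ B, t.depth q = no.depth q + 1) →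
      motive yes (A ∩ B) → motive no (A \ B) → motive t A)
    (t : ComparisonTree) : ∀ A : Set (ℝ × ℝ), MeasurableSet A → IsSublattice A →
      (∀ q ∈ A, t.eval q = rangeCount S q) → motive t A := by
  induction t with
  | leaf n =>
    exact fun A hA hl h => leaf n A hA hl
      (homogeneous_of_rangeCount_eq hl fun q hq => (h q hq).symm)
  | node a c s yes no ihy ihn =>
    intro A hA hl h
    obtain ⟨I, hI, hT⟩ := exists_setOf_test_eq a c s
    refine node _ yes no A (a.coord ⁻¹' I) hA (a.measurable_coord hI) ?_ ?_ ?_ ?_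
    · exact fun q hq => by simp [depth, (hT q).2 hq]
    · exact fun q hq => by simp [depth, (hT q).not.2 hq]
    · refine ihy _ (hA.inter (a.measurable_coord hI))
        (hl.inter (a.isSublattice_preimage_coord I)) fun q hq => ?_
      rw [← h q hq.1, eval, if_pos ((hT q).2 hq.2)]
    · refine ihn _ (hA.diff (a.measurable_coord hI))
        (hl.inter (a.isSublattice_preimage_coord Iᶜ)) fun q hq => ?_
      rw [← h q hq.1, eval, if_neg ((hT q).not.2 hq.2)]

/-- A Kraft inequality. -/
theorem lintegral_pow_depth_mul_le {S : Finset (ℝ × ℝ)} {t : ComparisonTree} (ht : t.Solves S)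
    (D : Measure (ℝ × ℝ)) (g : ℝ × ℝ → ℝ≥0∞) (C : ℝ≥0∞)
    (hg : ∀ A, MeasurableSet A → IsSublattice A → Homogeneous S A → ∫⁻ q in A, g q ∂D ≤ C) :
    ∫⁻ q, 2⁻¹ ^ t.depth q * g q ∂D ≤ C := by
  have key := induction_on_sets (S := S)
    (motive := fun t A => ∫⁻ q in A, 2⁻¹ ^ t.depth q * g q ∂D ≤ C) ?_ ?_ t Set.univ
    MeasurableSet.univ isSublattice_univ (fun q _ => ht q)
  · simpa using key
  · intro n A hA hl hh
    simpa [depth] using hg A hA hl hh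
  · intro t yes no A B hA hB h1 h2 ihy ihn
    have half : ∀ (t' : ComparisonTree) (E : Set (ℝ × ℝ)), MeasurableSet E →
        (∀ q ∈ E, t.depth q = t'.depth q + 1) →
        ∫⁻ q in E, 2⁻¹ ^ t.depth q * g q ∂D = 2⁻¹ * ∫⁻ q in E, 2⁻¹ ^ t'.depth q * g q ∂D := by
      intro t' E hE hd
      rw [← lintegral_const_mul' _ _ (by simp)]
      refine setLIntegral_congr_fun hE fun q hq => ?_
      rw [hd q hq, pow_succ', mul_assoc]
    rw [← lintegral_inter_add_sdiff _ A hB, half yes _ (hA.inter hB) fun q hq => h1 q hq.2,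
      half no _ (hA.diff hB) fun q hq => h2 q hq.2]
    -- Both subtrees satisfy the bound `C`, and the additional comparison halves each contribution.
    calc _ ≤ 2⁻¹ * C + 2⁻¹ * C := by gcongr
      _ = C := by rw [← add_mul, ENNReal.inv_two_add_inv_two, one_mul]

end ComparisonTree

/-! ### The entropy bound -/

namespace Real

theorem negMulLog_add_le {x y : ℝ} (hx : 0 ≤ x) (hy : 0 ≤ y) :
    negMulLog (x + y) ≤ negMulLog x + negMulLog y := by
  have aux : ∀ {x y : ℝ}, 0 ≤ x → 0 ≤ y → x * log x ≤ x * log (x + y) := by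
    intro x y hx hy
    rcases hx.eq_or_lt with rfl | hx
    · simp
    · exact mul_le_mul_of_nonneg_left (log_le_log hx (by linarith)) hx.le
  have h1 := aux hx hy
  have h2 := aux hy hx
  rw [add_comm y x] at h2
  simp only [negMulLog]
  linarith

/-- Midpoint concavity: splitting a mass in two gains at most one bit of entropy per unit of mass.
-/
theorem negMulLog_add_negMulLog_le {x y : ℝ} (hx : 0 ≤ x) (hy : 0 ≤ y) :
    negMulLog x + negMulLog y ≤ negMulLog (x + y) + (x + y) * log 2 := by
  have h := concaveOn_negMulLog.2 (Set.mem_Ici.2 hx) (Set.mem_Ici.2 hy)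
    (by norm_num : (0 : ℝ) ≤ 2⁻¹) (by norm_num : (0 : ℝ) ≤ 2⁻¹) (by norm_num)
  simp only [smul_eq_mul, ← mul_add] at h
  rw [negMulLog_mul] at h
  have h2 : negMulLog 2⁻¹ = 2⁻¹ * log 2 := by
    rw [negMulLog, log_inv]
    ring
  rw [h2] at h
  linarith

end Real

open Real in
/-- If the value of `f` is determined by the leaf reached, then the expected number of comparisons is
at least the entropy of `f`. -/
theorem ComparisonTree.sum_negMulLog_le {S : Finset (ℝ × ℝ)} {t : ComparisonTree}
    (ht : t.Solves S) (P : Measure (ℝ × ℝ)) [IsProbabilityMeasure P] {s : Set (ℝ × ℝ)}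
    (hs : P sᶜ = 0) {f : ℝ × ℝ → ℕ} {m : ℕ} (hm : ∀ q, f q < m)
    (hconst : ∀ A, Homogeneous S A → ∀ q ∈ A ∩ s, ∀ q' ∈ A ∩ s, f q = f q') :
    ENNReal.ofReal (∑ i ∈ Finset.range m, negMulLog (P.real {q | f q = i}) / log 2) ≤
      ∫⁻ q, (t.depth q : ℝ≥0∞) ∂P := by
  have hlog : 0 < log 2 := log_pos one_lt_two
  have key := induction_on_sets (S := S)
    -- For unnormalised masses, this quotient is P(A) times the entropy of `f` conditioned on `A`.
    -- It vanishes at a leaf and grows by at most P(A) with each comparison.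
    (motive := fun t A => ENNReal.ofReal ((∑ i ∈ Finset.range m,
        negMulLog (P.real (A ∩ {q | f q = i})) - negMulLog (P.real A)) / log 2) ≤
      ∫⁻ q in A, (t.depth q : ℝ≥0∞) ∂P) ?_ ?_ t Set.univ
    MeasurableSet.univ isSublattice_univ (fun q _ => ht q)
  · simpa [Finset.sum_div] using key
  · intro n A hA hl hh
    obtain ⟨i₀, hi₀, h0⟩ : ∃ i₀ < m, ∀ q ∈ A ∩ s, f q = i₀ := by
      by_cases hne : (A ∩ s).Nonempty
      · obtain ⟨q₀, hq₀⟩ := hne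
        exact ⟨f q₀, hm q₀, fun q hq => hconst A hh q hq q₀ hq₀⟩
      · rw [Set.not_nonempty_iff_eq_empty] at hne
        -- With no query in `A ∩ s`, any index below `m` serves; evaluating `f` at the origin shows
        -- that `m` is positive.
        exact ⟨0, (Nat.zero_le _).trans_lt (hm 0), by simp [hne]⟩
    have hz : ∀ i ≠ i₀, P.real (A ∩ {q | f q = i}) = 0 := by
      intro i hi
      rw [measureReal_eq_zero_iff]
      have hsub : A ∩ {q | f q = i} ⊆ sᶜ := fun q hq hqs =>
        hi (hq.2.symm.trans (h0 q ⟨hq.1, hqs⟩))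
      exact measure_mono_null hsub hs
    have hall : P.real (A ∩ {q | f q = i₀}) = P.real A := by
      refine measureReal_congr ?_
      have hae : ∀ᵐ q ∂P, q ∈ s := by rwa [ae_iff]
      filter_upwards [hae] with q hq
      exact propext ⟨fun h => h.1, fun h => ⟨h, h0 q ⟨h, hq⟩⟩⟩
    rw [Finset.sum_eq_single i₀ (fun i _ hi => by rw [hz i hi, negMulLog_zero])
      (fun h => absurd (Finset.mem_range.2 hi₀) h), hall]
    simp
  · intro t yes no A B hA hB h1 h2 ihy ihn
    have half : ∀ (t' : ComparisonTree) (E : Set (ℝ × ℝ)), MeasurableSet E →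
        (∀ q ∈ E, t.depth q = t'.depth q + 1) →
        ∫⁻ q in E, (t.depth q : ℝ≥0∞) ∂P =
          ∫⁻ q in E, (t'.depth q : ℝ≥0∞) ∂P + ENNReal.ofReal (P.real E) := by
      intro t' E hE hd
      rw [setLIntegral_congr_fun hE (g := fun q => (t'.depth q : ℝ≥0∞) + 1)
        (fun q hq => by simp [hd q hq]), lintegral_add_right _ measurable_const]
      simp
    have hsplit : ∀ E : Set (ℝ × ℝ), P.real E = P.real (E ∩ B) + P.real (E \ B) :=
      fun E => (measureReal_inter_add_sdiff hB).symm
    rw [← lintegral_inter_add_sdiff _ A hB, half yes _ (hA.inter hB) fun q hq => h1 q hq.2,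
      half no _ (hA.diff hB) fun q hq => h2 q hq.2]
    refine le_trans ?_ (add_le_add (add_le_add_left ihy _) (add_le_add_left ihn _))
    refine le_trans ?_ (add_le_add ENNReal.ofReal_add_le ENNReal.ofReal_add_le)
    refine le_trans (ENNReal.ofReal_le_ofReal ?_) ENNReal.ofReal_add_le
    have hsum : ∑ i ∈ Finset.range m, negMulLog (P.real (A ∩ {q | f q = i})) ≤
        ∑ i ∈ Finset.range m, negMulLog (P.real (A ∩ B ∩ {q | f q = i})) +
        ∑ i ∈ Finset.range m, negMulLog (P.real (A \ B ∩ {q | f q = i})) := by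
      rw [← Finset.sum_add_distrib]
      refine Finset.sum_le_sum fun i _ => ?_
      rw [hsplit (A ∩ {q | f q = i}), Set.inter_right_comm,
        show (A ∩ {q | f q = i}) \ B = A \ B ∩ {q | f q = i} from by
          ext q; simp only [Set.mem_sdiff, Set.mem_inter_iff]; tauto]
      exact negMulLog_add_le measureReal_nonneg measureReal_nonneg
    have htot := negMulLog_add_negMulLog_le (measureReal_nonneg (μ := P) (s := A ∩ B))
      (measureReal_nonneg (μ := P) (s := A \ B))
    rw [← hsplit A] at htot
    have hfrac : ∀ u v x y : ℝ, u / log 2 + x + (v / log 2 + y) =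
        (u + v + (x + y) * log 2) / log 2 := by
      intro u v x y
      field_simp
      ring
    rw [hfrac, div_le_div_iff_of_pos_right hlog, ← hsplit A]
    linarith

/-! ### Regions -/

section Regions

variable {r : Set (ℝ × ℝ)} {a : Axis} {lo hi : EReal}

theorem Axis.measurable_coe_coord (a : Axis) : Measurable fun q => (a.coord q : EReal) :=
  measurable_coe_real_ereal.comp a.measurable_coord

theorem measurableSet_leftPart (hr : MeasurableSet r) : MeasurableSet (leftPart r a lo) :=
  hr.inter (a.measurable_coe_coord measurableSet_Iic)

theorem measurableSet_rightPart (hr : MeasurableSet r) : MeasurableSet (rightPart r a hi) :=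
  hr.inter (a.measurable_coe_coord measurableSet_Ioi)

theorem measurableSet_stripPart (hr : MeasurableSet r) : MeasurableSet (stripPart r a lo hi) :=
  hr.inter (a.measurable_coe_coord measurableSet_Ioc)

theorem leftPart_subset : leftPart r a lo ⊆ r := fun _ h => h.1

theorem rightPart_subset : rightPart r a hi ⊆ r := fun _ h => h.1

theorem stripPart_subset : stripPart r a lo hi ⊆ r := fun _ h => h.1

theorem subset_union_parts : r ⊆ leftPart r a lo ∪ stripPart r a lo hi ∪ rightPart r a hi := by
  intro q hq
  by_cases h1 : (a.coord q : EReal) ≤ lo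
  · exact .inl (.inl ⟨hq, h1⟩)
  · by_cases h2 : (a.coord q : EReal) ≤ hi
    · exact .inl (.inr ⟨hq, not_le.1 h1, h2⟩)
    · exact .inr ⟨hq, not_le.1 h2⟩

theorem setLIntegral_le_add_parts (D : Measure (ℝ × ℝ)) (R : Set (ℝ × ℝ)) (f : ℝ × ℝ → ℝ≥0∞) :
    ∫⁻ q in R ∩ r, f q ∂D ≤ ∫⁻ q in R ∩ leftPart r a lo, f q ∂D +
      ∫⁻ q in R ∩ stripPart r a lo hi, f q ∂D + ∫⁻ q in R ∩ rightPart r a hi, f q ∂D := by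
  refine (lintegral_mono_set (Set.inter_subset_inter_right R
    (subset_union_parts (a := a) (lo := lo) (hi := hi)))).trans ?_
  rw [Set.inter_union_distrib_left, Set.inter_union_distrib_left]
  exact (lintegral_union_le _ _ _).trans (add_le_add_left (lintegral_union_le _ _ _) _)

end Regions

namespace IsSplitStrip

variable {S : Finset (ℝ × ℝ)} {D : Measure (ℝ × ℝ)} {r : Set (ℝ × ℝ)} {a : Axis} {lo hi : EReal}

theorem exists_mem_leftPart (h : IsSplitStrip S D r a lo hi) {q : ℝ × ℝ}
    (hq : q ∈ leftPart r a lo) :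
    ∃ p ∈ S, p ∈ leftPart r a lo ∧ lo = (a.coord p : EReal) := by
  rcases h.lo_mem with h' | ⟨p, hp, hr, h'⟩
  · exact absurd (h' ▸ hq.2) (by simp)
  · exact ⟨p, hp, ⟨hr, h'.ge⟩, h'⟩

theorem real_leftPart_le [IsFiniteMeasure D] (h : IsSplitStrip S D r a lo hi) :
    D.real (leftPart r a lo) ≤ D.real r / 2 := by
  have := ENNReal.toReal_mono (by finiteness) h.left_le
  simpa [Measure.real] using this

theorem real_rightPart_le [IsFiniteMeasure D] (h : IsSplitStrip S D r a lo hi) :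
    D.real (rightPart r a hi) ≤ D.real r / 2 := by
  have := ENNReal.toReal_mono (by finiteness) h.right_le
  simpa [Measure.real] using this

end IsSplitStrip

/-! ### The depth of the node reached in Step 1 -/

/-- The set `R` reaches at least as far down as `r` along the axis `c`. -/
def ReachesBelow (R r : Set (ℝ × ℝ)) (c : Axis) : Prop :=
  ∃ z ∈ R, ∀ w ∈ r, c.coord z ≤ c.coord w

theorem ReachesBelow.mono {R r r' : Set (ℝ × ℝ)} {c : Axis} (h : ReachesBelow R r c)
    (hr : r' ⊆ r) : ReachesBelow R r' c :=
  h.imp fun _ hz => ⟨hz.1, fun w hw => hz.2 w (hr hw)⟩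

theorem reachesBelow_rightPart {R r : Set (ℝ × ℝ)} {a : Axis} {lo hi : EReal} (hlt : lo < hi)
    (h : (R ∩ leftPart r a lo).Nonempty) : ReachesBelow R (rightPart r a hi) a := by
  obtain ⟨z, hzR, hz⟩ := h
  exact ⟨z, hzR, fun w hw => EReal.coe_le_coe_iff.1 (hz.2.trans (hlt.trans hw.2).le)⟩

/-- Take a point `p` of `S` on the line `lo`. The meet of a low query of `R` with one in the left
part is a query of `R` that has `p` in its range. By homogeneity every query of `R` then has `p` in
its range, which is impossible beyond `hi > lo`. -/
theorem ReachesBelow.not_left_and_right {S : Finset (ℝ × ℝ)} {D : Measure (ℝ × ℝ)}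
    {R r : Set (ℝ × ℝ)} {a : Axis} {lo hi : EReal} (h : ReachesBelow R r a.other)
    (hR : IsSublattice R) (hS : Homogeneous S R) (hs : IsSplitStrip S D r a lo hi) :
    R ∩ leftPart r a lo = ∅ ∨ R ∩ rightPart r a hi = ∅ := by
  by_contra! hne
  obtain ⟨⟨q, hqR, hq⟩, q', hqR', hq'⟩ := hne
  obtain ⟨z, hzR, hz⟩ := h
  obtain ⟨p, hpS, hp, hlo⟩ := hs.exists_mem_leftPart hq
  have h1 : z ⊓ q ≤ p := by
    rw [le_iff_coord a, Axis.coord_inf, Axis.coord_inf]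
    exact ⟨inf_le_right.trans (EReal.coe_le_coe_iff.1 (hlo ▸ hq.2)), inf_le_left.trans (hz p hp.1)⟩
  have h2 := hS p hpS ⟨_, hR.infClosed hzR hqR, h1⟩ q' hqR'
  have h3 := EReal.coe_le_coe_iff.2 ((le_iff_coord a q' p).1 h2).1
  rw [← hlo] at h3
  exact absurd (h3.trans_lt hs.lo_lt_hi) (not_lt.2 hq'.2.le)

namespace PrimaryTree

/-- The weight `(5 / 4) ^ level`. -/
noncomputable def weight (t : PrimaryTree) (q : ℝ × ℝ) : ℝ≥0∞ :=
  ENNReal.ofReal ((5 / 4) ^ t.level q)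

theorem setLIntegral_weight_succ (D : Measure (ℝ × ℝ)) (t t' : PrimaryTree)
    {E : Set (ℝ × ℝ)} (hE : MeasurableSet E)
    (h : ∀ q ∈ E, t.level q = t'.level q + 1) :
    ∫⁻ q in E, t.weight q ∂D = ENNReal.ofReal (5 / 4) * ∫⁻ q in E, t'.weight q ∂D := by
  rw [← lintegral_const_mul' _ _ (by simp)]
  refine setLIntegral_congr_fun hE fun q hq => ?_
  simp only [weight]
  rw [h q hq, pow_succ', ENNReal.ofReal_mul (by norm_num)]

section Weight

variable {D : Measure (ℝ × ℝ)} [IsFiniteMeasure D] {R r : Set (ℝ × ℝ)}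

theorem setLIntegral_weight_leaf_le (bad : Bool) (cat : Axis → Catalogue) :
    ∫⁻ q in R ∩ r, (leaf bad cat).weight q ∂D ≤ ENNReal.ofReal (D.real r) := by
  simp only [weight, level, pow_zero, ENNReal.ofReal_one, lintegral_const, one_mul,
    Measure.restrict_apply_univ]
  rw [ofReal_measureReal]
  exact measure_mono Set.inter_subset_right

theorem setLIntegral_weight_node_le {a : Axis} {lo hi : EReal} (hlt : lo < hi)
    (cat : Axis → Catalogue) {left right : PrimaryTree} (hR : MeasurableSet R)
    (hr : MeasurableSet r) {x y : ℝ} (hx : 0 ≤ x) (hy : 0 ≤ y)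
    (hl : ∫⁻ q in R ∩ leftPart r a lo, left.weight q ∂D ≤ ENNReal.ofReal x)
    (hri : ∫⁻ q in R ∩ rightPart r a hi, right.weight q ∂D ≤ ENNReal.ofReal y) :
    ∫⁻ q in R ∩ r, (node a lo hi cat left right).weight q ∂D ≤
      ENNReal.ofReal (D.real r + 5 / 4 * (x + y)) := by
  set t := node a lo hi cat left right with ht
  have h1 : ∫⁻ q in R ∩ leftPart r a lo, t.weight q ∂D =
      ENNReal.ofReal (5 / 4) * ∫⁻ q in R ∩ leftPart r a lo, left.weight q ∂D := by
    refine setLIntegral_weight_succ _ _ _ (hR.inter (measurableSet_leftPart hr)) fun q hq => ?_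
    rw [ht, level, if_neg (not_lt.2 (hq.2.2.trans hlt.le)), if_pos hq.2.2]
  have h2 : ∫⁻ q in R ∩ rightPart r a hi, t.weight q ∂D =
      ENNReal.ofReal (5 / 4) * ∫⁻ q in R ∩ rightPart r a hi, right.weight q ∂D := by
    refine setLIntegral_weight_succ _ _ _ (hR.inter (measurableSet_rightPart hr)) fun q hq => ?_
    rw [ht, level, if_pos hq.2.2]
  have h3 : ∫⁻ q in R ∩ stripPart r a lo hi, t.weight q ∂D ≤ ENNReal.ofReal (D.real r) := by
    rw [setLIntegral_congr_fun (hR.inter (measurableSet_stripPart hr)) (g := fun _ => 1)]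
    · simp only [lintegral_const, one_mul, Measure.restrict_apply_univ]
      rw [ofReal_measureReal]
      exact measure_mono (Set.inter_subset_right.trans stripPart_subset)
    · intro q hq
      simp [ht, weight, level, not_lt.2 hq.2.2.2, not_le.2 hq.2.2.1]
  refine (setLIntegral_le_add_parts (a := a) (lo := lo) (hi := hi) D R _).trans ?_
  rw [h1, h2, mul_add, ENNReal.ofReal_add measureReal_nonneg (by positivity),
    ENNReal.ofReal_add (by positivity) (by positivity), ENNReal.ofReal_mul (by norm_num),
    ENNReal.ofReal_mul (by norm_num)]
  calc _ ≤ ENNReal.ofReal (5 / 4) * ENNReal.ofReal x + ENNReal.ofReal (D.real r) +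
        ENNReal.ofReal (5 / 4) * ENNReal.ofReal y := by gcongr
    _ = _ := by ring

variable {κ ρ : ℕ} {S : Finset (ℝ × ℝ)}

/-- The axes alternate, so at every second level only one child, of at most half the probability,
meets `R`. The constants are chosen to satisfy 1 + (5/4)(17/2) ≤ 12 and 1 + (5/4)(12/2) ≤ 17/2, one
inequality for each kind of level. -/
theorem IsFor.setLIntegral_weight_le_of_reachesBelow {t : PrimaryTree} (hR : MeasurableSet R)
    (hRl : IsSublattice R) (hS : Homogeneous S R) :
    ∀ {d : ℕ} {r : Set (ℝ × ℝ)} {own : Axis → Finset (ℝ × ℝ)} {up : Axis → List ℝ}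
      {W : Option (Set (ℝ × ℝ))}, t.IsFor κ ρ S D d r own up W → MeasurableSet r →
      (ReachesBelow R r (axisAt d) →
        ∫⁻ q in R ∩ r, t.weight q ∂D ≤ ENNReal.ofReal (12 * D.real r)) ∧
      (ReachesBelow R r (axisAt d).other →
        ∫⁻ q in R ∩ r, t.weight q ∂D ≤ ENNReal.ofReal (17 / 2 * D.real r)) := by
  induction t with
  | leaf bad cat =>
    intro d r own up W h hr
    have h0 : 0 ≤ D.real r := measureReal_nonneg
    exact ⟨fun _ => (setLIntegral_weight_leaf_le bad cat).trans
      (ENNReal.ofReal_le_ofReal (by linarith)), fun _ => (setLIntegral_weight_leaf_le bad cat).trans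
      (ENNReal.ofReal_le_ofReal (by linarith))⟩
  | node a lo hi cat left right ihl ihr =>
    intro d r own up W h hr
    obtain ⟨hsplit, ha, hstrip, hcat, hleft, hright⟩ := h
    obtain ⟨hl1, hl2⟩ := ihl hleft (measurableSet_leftPart hr)
    obtain ⟨hr1, hr2⟩ := ihr hright (measurableSet_rightPart hr)
    rw [axisAt_succ, ← ha] at hl1 hl2 hr1 hr2
    rw [Axis.other_other] at hl2 hr2
    have hDl := hstrip.real_leftPart_le
    have hDr := hstrip.real_rightPart_le
    have h0 : 0 ≤ D.real r := measureReal_nonneg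
    have h0l : 0 ≤ D.real (leftPart r a lo) := measureReal_nonneg
    have h0r : 0 ≤ D.real (rightPart r a hi) := measureReal_nonneg
    rw [← ha]
    constructor
    · intro hb
      refine (setLIntegral_weight_node_le hstrip.lo_lt_hi cat hR hr (by positivity) (by positivity)
        (hl2 (hb.mono leftPart_subset)) (hr2 (hb.mono rightPart_subset))).trans
        (ENNReal.ofReal_le_ofReal ?_)
      linarith
    · intro hb
      rcases hb.not_left_and_right hRl hS hstrip with he | he
      · refine (setLIntegral_weight_node_le hstrip.lo_lt_hi cat hR hr le_rfl (by positivity)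
          (by simp [he]) (hr1 (hb.mono rightPart_subset))).trans (ENNReal.ofReal_le_ofReal ?_)
        linarith
      · refine (setLIntegral_weight_node_le hstrip.lo_lt_hi cat hR hr (by positivity) le_rfl
          (hl1 (hb.mono leftPart_subset)) (by simp [he])).trans (ENNReal.ofReal_le_ofReal ?_)
        linarith

/-- If `R` meets the left part, it reaches below the right part along the cut axis, where the bound
17/2 is available. Only the left child, with at most half the probability, needs the general bound:
1 + (5/4)(17/2 + 17/4) ≤ 17. If `R` misses the left part, the recursion continues in the right child
alone. -/
theorem IsFor.setLIntegral_weight_le {t : PrimaryTree} (hR : MeasurableSet R)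
    (hRl : IsSublattice R) (hS : Homogeneous S R) :
    ∀ {d : ℕ} {r : Set (ℝ × ℝ)} {own : Axis → Finset (ℝ × ℝ)} {up : Axis → List ℝ}
      {W : Option (Set (ℝ × ℝ))}, t.IsFor κ ρ S D d r own up W → MeasurableSet r →
      ∫⁻ q in R ∩ r, t.weight q ∂D ≤ ENNReal.ofReal (17 * D.real r) := by
  induction t with
  | leaf bad cat =>
    intro d r own up W h hr
    have h0 : 0 ≤ D.real r := measureReal_nonneg
    exact (setLIntegral_weight_leaf_le bad cat).trans (ENNReal.ofReal_le_ofReal (by linarith))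
  | node a lo hi cat left right ihl ihr =>
    intro d r own up W h hr
    obtain ⟨hsplit, ha, hstrip, hcat, hleft, hright⟩ := h
    have hDl := hstrip.real_leftPart_le
    have hDr := hstrip.real_rightPart_le
    have h0 : 0 ≤ D.real r := measureReal_nonneg
    have h0l : 0 ≤ D.real (leftPart r a lo) := measureReal_nonneg
    have h0r : 0 ≤ D.real (rightPart r a hi) := measureReal_nonneg
    by_cases he : (R ∩ leftPart r a lo).Nonempty
    · have hb := reachesBelow_rightPart hstrip.lo_lt_hi he
      have hr2 := (hright.setLIntegral_weight_le_of_reachesBelow hR hRl hS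
        (measurableSet_rightPart hr)).2
      rw [axisAt_succ, Axis.other_other, ← ha] at hr2
      refine (setLIntegral_weight_node_le hstrip.lo_lt_hi cat hR hr (by positivity) (by positivity)
        (ihl hleft (measurableSet_leftPart hr)) (hr2 hb)).trans (ENNReal.ofReal_le_ofReal ?_)
      linarith
    · rw [Set.not_nonempty_iff_eq_empty] at he
      refine (setLIntegral_weight_node_le hstrip.lo_lt_hi cat hR hr le_rfl (by positivity)
        (by simp [he]) (ihr hright (measurableSet_rightPart hr))).trans
        (ENNReal.ofReal_le_ofReal ?_)
      linarith

end Weight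

/-- Since (5/4)^4 > 2, a level of 4j + m at depth j leaves 2^(-j) (5/4)^level ≥ (5/4)^m ≥ 1 + m/4.
-/
theorem level_le_depth_add (t : PrimaryTree) (t' : ComparisonTree) (q : ℝ × ℝ) :
    (t.level q : ℝ≥0∞) ≤ 4 * t'.depth q + 4 * (2⁻¹ ^ t'.depth q * t.weight q) := by
  set k := t.level q with hk
  set j := t'.depth q
  have hreal : (k : ℝ) ≤ 4 * j + 4 * ((2⁻¹ : ℝ) ^ j * (5 / 4) ^ k) := by
    rcases le_total k (4 * j) with h | h
    · have : (k : ℝ) ≤ 4 * j := by exact_mod_cast h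
      have : (0 : ℝ) ≤ (2⁻¹ : ℝ) ^ j * (5 / 4) ^ k := by positivity
      linarith
    · obtain ⟨m, hm⟩ := Nat.exists_eq_add_of_le h
      have h1 : (1 : ℝ) ≤ (2⁻¹ : ℝ) ^ j * ((5 / 4) ^ 4) ^ j := by
        rw [← mul_pow]
        exact one_le_pow₀ (by norm_num)
      have h2 : 1 + (m : ℝ) * (1 / 4) ≤ (5 / 4) ^ m := by
        have := one_add_mul_le_pow (a := (1 / 4 : ℝ)) (by norm_num) m
        norm_num at this ⊢
        exact this
      have h3 : (5 / 4 : ℝ) ^ m ≤ (2⁻¹ : ℝ) ^ j * (5 / 4) ^ (4 * j + m) := by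
        rw [pow_add, pow_mul, ← mul_assoc]
        exact le_mul_of_one_le_left (by positivity) h1
      rw [hm]
      push_cast
      linarith
  have h := ENNReal.ofReal_le_ofReal hreal
  rw [ENNReal.ofReal_natCast] at h
  refine h.trans_eq ?_
  rw [ENNReal.ofReal_add (by positivity) (by positivity), ENNReal.ofReal_mul (by norm_num),
    ENNReal.ofReal_mul (by norm_num), ENNReal.ofReal_mul (by positivity),
    ENNReal.ofReal_pow (by norm_num), ENNReal.ofReal_inv_of_pos (by norm_num)]
  simp [weight, ← hk]

/-- The expected depth of the node reached in Step 1 is at most a constant times the cost of any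
comparison tree. -/
theorem IsFor.lintegral_level_le {κ ρ : ℕ} {S : Finset (ℝ × ℝ)} {D : Measure (ℝ × ℝ)}
    [IsProbabilityMeasure D] {t : PrimaryTree} {own : Axis → Finset (ℝ × ℝ)} {up : Axis → List ℝ}
    {W : Option (Set (ℝ × ℝ))} (h : t.IsFor κ ρ S D 0 Set.univ own up W) {t' : ComparisonTree}
    (ht' : t'.Solves S) (hmeas : Measurable t'.depth) :
    ∫⁻ q, (t.level q : ℝ≥0∞) ∂D ≤ 4 * t'.expectedTime D + 68 := by
  refine (lintegral_mono (level_le_depth_add t t')).trans ?_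
  have hm : Measurable fun q => (t'.depth q : ℝ≥0∞) := measurable_from_top.comp hmeas
  rw [lintegral_add_left (hm.const_mul _), lintegral_const_mul _ hm,
    lintegral_const_mul' _ _ (by simp)]
  have hK := ComparisonTree.lintegral_pow_depth_mul_le ht' D t.weight 17 fun A hA hl hS => by
    simpa using h.setLIntegral_weight_le hA hl hS MeasurableSet.univ
  refine add_le_add le_rfl ((mul_le_mul_right hK 4).trans_eq ?_)
  norm_num

end PrimaryTree

/-! ### The cost of the searches in Step 2 -/

namespace ComparisonTree

theorem measurable_depth (t : ComparisonTree) : Measurable t.depth := by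
  classical
  induction t with
  | leaf n => exact measurable_const
  | node a c s yes no ihy ihn =>
    obtain ⟨I, hI, hT⟩ := exists_setOf_test_eq a c s
    have h : (node a c s yes no).depth =
        fun q => (if q ∈ a.coord ⁻¹' I then yes.depth q else no.depth q) + 1 := by
      funext q
      simp only [depth, hT]
    rw [h]
    exact (Measurable.ite (a.measurable_coord hI) ihy ihn).add_const 1

/-- A lone leaf cannot give both the positive count at a point of `S` and the count 0 far to the
right. This is what later absorbs the additive constants. -/
theorem one_le_depth {S : Finset (ℝ × ℝ)} (hS : S.Nonempty) {t : ComparisonTree}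
    (ht : t.Solves S) (q : ℝ × ℝ) : 1 ≤ t.depth q := by
  cases t with
  | node a c s yes no => simp [depth]
  | leaf n =>
    obtain ⟨p, hp⟩ := hS
    have h1 : n = rangeCount S p := ht p
    obtain ⟨M, hM⟩ := (S.image Prod.fst).bddAbove
    have h2 : n = rangeCount S (M + 1, 0) := ht _
    have h3 : 0 < rangeCount S p := by
      rw [rangeCount_eq, Finset.card_pos]
      exact ⟨p, Finset.mem_filter.2 ⟨hp, le_rfl⟩⟩
    have h4 : rangeCount S (M + 1, 0) = 0 := by
      rw [rangeCount_eq, Finset.card_eq_zero, Finset.filter_eq_empty_iff]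
      intro p' hp' hle
      have h5 := hM (Finset.mem_coe.2 (Finset.mem_image_of_mem Prod.fst hp'))
      have h6 : M + 1 ≤ p'.1 := hle.1
      linarith
    omega

theorem one_le_expectedTime {S : Finset (ℝ × ℝ)} (hS : S.Nonempty) {t : ComparisonTree}
    (ht : t.Solves S) (D : Measure (ℝ × ℝ)) [IsProbabilityMeasure D] : 1 ≤ t.expectedTime D := by
  calc (1 : ℝ≥0∞) = ∫⁻ _, 1 ∂D := by simp
    _ ≤ t.expectedTime D := lintegral_mono fun q =>
        Nat.one_le_cast.2 (one_le_depth hS ht q)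

end ComparisonTree

theorem SearchTree.measurable_depth (t : SearchTree) : Measurable t.depth := by
  induction t with
  | leaf i => exact measurable_const
  | node key l r ihl ihr => exact (Measurable.ite measurableSet_Iic ihl ihr).add_const 1

/-- All entries of `L` are `b`-coordinates of points that are not before `s` along the other axis. -/
def Beyond (S : Finset (ℝ × ℝ)) (s : Set (ℝ × ℝ)) (b : Axis) (L : List ℝ) : Prop :=
  ∀ x ∈ L, ∃ p ∈ S, b.coord p = x ∧ ∀ q ∈ s, b.other.coord q ≤ b.other.coord p

theorem Beyond.mono {S : Finset (ℝ × ℝ)} {s s' : Set (ℝ × ℝ)} {b : Axis} {L : List ℝ}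
    (h : Beyond S s b L) (hs : s' ⊆ s) : Beyond S s' b L := fun x hx =>
  (h x hx).imp fun _ hp => ⟨hp.1, hp.2.1, fun q hq => hp.2.2 q (hs hq)⟩

/-- For queries in `s`, the coordinate `b` alone decides whether the points behind `L` are in range,
and homogeneity makes this decision the same throughout `A`. -/
theorem Beyond.rank_eq {S : Finset (ℝ × ℝ)} {s A : Set (ℝ × ℝ)} {b : Axis} {L : List ℝ}
    (h : Beyond S s b L) (hA : Homogeneous S A) {q q' : ℝ × ℝ} (hq : q ∈ A ∩ s)
    (hq' : q' ∈ A ∩ s) : rank L (b.coord q) = rank L (b.coord q') := by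
  have aux : ∀ {q q' : ℝ × ℝ}, q ∈ A ∩ s → q' ∈ A ∩ s →
      rank L (b.coord q') ≤ rank L (b.coord q) := by
    intro q q' hq hq'
    refine List.countP_mono_left fun x hx hlt => ?_
    rw [decide_eq_true_eq] at hlt ⊢
    by_contra hle
    obtain ⟨p, hp, rfl, hps⟩ := h x hx
    have h1 := hA p hp ⟨q, hq.1, (le_iff_coord b q p).2 ⟨not_lt.1 hle, hps q hq.2⟩⟩ q' hq'.1
    exact absurd ((le_iff_coord b q' p).1 h1).1 (not_le.2 hlt)
  exact le_antisymm (aux hq' hq) (aux hq hq')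

theorem Beyond.intervalEntropy_le {S : Finset (ℝ × ℝ)} {s : Set (ℝ × ℝ)} {b : Axis} {L : List ℝ}
    (h : Beyond S s b L) (P : Measure (ℝ × ℝ)) [IsProbabilityMeasure P] (hs : P sᶜ = 0)
    {t : ComparisonTree} (ht : t.Solves S) :
    ENNReal.ofReal (intervalEntropy P b L) ≤ ∫⁻ q, (t.depth q : ℝ≥0∞) ∂P :=
  ComparisonTree.sum_negMulLog_le ht P hs
    (fun _ => Nat.lt_succ_of_le (rank_le_length L _)) fun _ hA _ hq _ hq' => h.rank_eq hA hq hq'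

theorem setLIntegral_eq_mul_cond (D : Measure (ℝ × ℝ)) [IsFiniteMeasure D] {s : Set (ℝ × ℝ)}
    (hs : D s ≠ 0) (f : ℝ × ℝ → ℝ≥0∞) :
    ∫⁻ q in s, f q ∂D = D s * ∫⁻ q, f q ∂(ProbabilityTheory.cond D s) := by
  rw [ProbabilityTheory.cond, lintegral_smul_measure, smul_eq_mul, ← mul_assoc,
    ENNReal.mul_inv_cancel hs (measure_ne_top D s), one_mul]

/-- Conditioned on `s`, the entropy of the interval bounds the search from above, up to κ, and `t`
from below. -/
theorem IsBiasedSearchTree.setLIntegral_depth_le {κ : ℕ} {S : Finset (ℝ × ℝ)}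
    {D : Measure (ℝ × ℝ)} [IsFiniteMeasure D] {s : Set (ℝ × ℝ)} {b : Axis} {L : List ℝ}
    {i : SearchTree} (hi : IsBiasedSearchTree κ (ProbabilityTheory.cond D s) b L i)
    (hs : MeasurableSet s) (h : Beyond S s b L) {t : ComparisonTree} (ht : t.Solves S) :
    ∫⁻ q in s, (i.depth (b.coord q) : ℝ≥0∞) ∂D ≤ ∫⁻ q in s, ((t.depth q : ℝ≥0∞) + κ) ∂D := by
  by_cases h0 : D s = 0
  · rw [Measure.restrict_eq_zero.2 h0]
    simp
  rw [setLIntegral_eq_mul_cond D h0, setLIntegral_eq_mul_cond D h0]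
  have := ProbabilityTheory.cond_isProbabilityMeasure h0
  refine mul_le_mul_right ?_ _
  have hz : (ProbabilityTheory.cond D s) sᶜ = 0 := by
    rw [ProbabilityTheory.cond_apply hs]
    simp
  refine hi.cost_le.trans (ENNReal.ofReal_add_le.trans ?_)
  rw [lintegral_add_right _ measurable_const]
  refine add_le_add (h.intervalEntropy_le _ hz ht) ?_
  simp

namespace PrimaryTree

variable {κ ρ : ℕ} {S : Finset (ℝ × ℝ)} {D : Measure (ℝ × ℝ)}

theorem measurable_level (t : PrimaryTree) : Measurable t.level := by
  induction t with
  | leaf bad cat => exact measurable_const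
  | node a lo hi cat left right ihl ihr =>
    exact Measurable.ite (a.measurable_coe_coord measurableSet_Ioi) (ihr.add_const 1)
      (Measurable.ite (a.measurable_coe_coord measurableSet_Iic) (ihl.add_const 1) measurable_const)

theorem beyond_stored {P : Measure (ℝ × ℝ)} {b : Axis} {own : Finset (ℝ × ℝ)} {up : List ℝ}
    {C : Catalogue} (h : IsCatalogue κ ρ P b own up C) {s : Set (ℝ × ℝ)}
    (hown : ∀ p ∈ own, p ∈ S ∧ ∀ q ∈ s, b.other.coord q ≤ b.other.coord p)
    (hup : Beyond S s b up) : Beyond S s b C.stored := by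
  intro x hx
  have hx' : x ∈ (C.stored : Multiset ℝ) := hx
  rw [h.content, Multiset.mem_add, Multiset.mem_map] at hx'
  rcases hx' with ⟨p, hp, rfl⟩ | hx'
  · exact ⟨p, (hown p hp).1, rfl, (hown p hp).2⟩
  · exact hup x (mem_of_mem_sample hx')

theorem mem_leftOwn {r : Set (ℝ × ℝ)} {a b : Axis} {lo hi : EReal} (hlt : lo < hi) {p : ℝ × ℝ}
    (hp : p ∈ leftOwn S r a lo hi b) :
    b.other = a ∧ p ∈ S ∧ p ∈ r ∧ lo < (a.coord p : EReal) := by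
  classical
  by_cases hb : b = a.other
  · rw [leftOwn, if_pos hb, Finset.mem_filter] at hp
    refine ⟨by rw [hb, Axis.other_other], hp.1, ?_⟩
    rcases hp.2 with h | h
    · exact ⟨h.1, h.2.1⟩
    · exact ⟨h.1, hlt.trans h.2⟩
  · rw [leftOwn, if_neg hb] at hp
    simp at hp

/-- The points of `S` in the strip all lie on its closing line `hi`, so they are not before any
query of the strip either. -/
theorem leftOwn_beyond {r : Set (ℝ × ℝ)} {a b : Axis} {lo hi : EReal}
    (h : IsSplitStrip S D r a lo hi) {p : ℝ × ℝ} (hp : p ∈ leftOwn S r a lo hi b) :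
    p ∈ S ∧ ∀ q ∈ leftPart r a lo ∪ stripPart r a lo hi,
      b.other.coord q ≤ b.other.coord p := by
  obtain ⟨rfl, hS, hr, hlo⟩ := mem_leftOwn h.lo_lt_hi hp
  refine ⟨hS, fun q hq => EReal.coe_le_coe_iff.1 ?_⟩
  rcases hq with hq | hq
  · exact hq.2.trans hlo.le
  · exact hq.2.2.trans (IsSplitStrip.le_coord_of_lt h hS hr hlo)

/-- The stopping strips and leaf regions are disjoint, so the bounds conditioned on them add up. A
left child's search trees are biased for the strip of its parent and would give no bound if the
descent stopped at that child as a leaf. The condition on `W` excludes this: a nonempty left part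
contains a point of `S` on the line `lo`, so such a leaf is bad. -/
theorem IsFor.setLIntegral_indexCost_le [IsFiniteMeasure D] {t' : ComparisonTree}
    (ht' : t'.Solves S) {t : PrimaryTree} :
    ∀ {d : ℕ} {r : Set (ℝ × ℝ)} {own : Axis → Finset (ℝ × ℝ)} {up : Axis → List ℝ}
      {W : Option (Set (ℝ × ℝ))}, t.IsFor κ ρ S D d r own up W → MeasurableSet r →
      (∀ b, ∀ p ∈ own b, p ∈ S ∧ ∀ q ∈ r, b.other.coord q ≤ b.other.coord p) →
      (∀ b, Beyond S r b (up b)) →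
      (W = none ∨ (r.Nonempty → ∃ p ∈ S, p ∈ r)) →
      ∫⁻ q in r, (t.indexCost q : ℝ≥0∞) ∂D ≤ 2 * ∫⁻ q in r, ((t'.depth q : ℝ≥0∞) + κ) ∂D := by
  have two : ∀ {u : Axis → Catalogue} {s : Set (ℝ × ℝ)}, MeasurableSet s →
      (∀ b, IsBiasedSearchTree κ (ProbabilityTheory.cond D s) b (u b).stored (u b).index) →
      (∀ b, Beyond S s b (u b).stored) →
      ∫⁻ q in s, (((u .x).index.depth q.1 + (u .y).index.depth q.2 : ℕ) : ℝ≥0∞) ∂D ≤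
        2 * ∫⁻ q in s, ((t'.depth q : ℝ≥0∞) + κ) ∂D := by
    intro u s hs hi hb
    have hm : Measurable fun q : ℝ × ℝ => ((u .x).index.depth q.1 : ℝ≥0∞) :=
      measurable_from_top.comp ((u .x).index.measurable_depth.comp measurable_fst)
    simp only [Nat.cast_add]
    rw [lintegral_add_left hm, two_mul]
    exact add_le_add ((hi .x).setLIntegral_depth_le hs (hb .x) ht')
      ((hi .y).setLIntegral_depth_le hs (hb .y) ht')
  induction t with
  | leaf bad cat =>
    intro d r own up W h hr hown hup hW
    obtain ⟨hsplit, hbad, hcat⟩ := h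
    cases bad with
    | true => simp [indexCost]
    | false =>
      simp only [Bool.false_eq_true, false_iff] at hbad
      by_cases hne : r.Nonempty
      · obtain rfl : W = none := hW.resolve_right fun h => hbad (h hne)
        simp only [indexCost, Bool.false_eq_true, if_false]
        exact two hr (fun b => (hcat b).index_biased)
          fun b => beyond_stored (hcat b) (hown b) (hup b)
      · rw [Set.not_nonempty_iff_eq_empty] at hne
        simp [hne]
  | node a lo hi cat left right ihl ihr =>
    intro d r own up W h hr hown hup hW
    obtain ⟨hsplit, ha, hstrip, hcat, hleft, hright⟩ := h
    have hst : ∀ b, Beyond S r b (cat b).stored :=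
      fun b => beyond_stored (hcat b) (hown b) (hup b)
    have hlm := measurableSet_leftPart (a := a) (lo := lo) hr
    have hsm := measurableSet_stripPart (a := a) (lo := lo) (hi := hi) hr
    have hrm := measurableSet_rightPart (a := a) (hi := hi) hr
    have hl := ihl hleft hlm
      (fun b p hp => (leftOwn_beyond hstrip hp).imp_right fun h q hq => h q (.inl hq))
      (fun b => (hst b).mono leftPart_subset)
      (.inr fun ⟨q, hq⟩ => (hstrip.exists_mem_leftPart hq).imp fun p hp => ⟨hp.1, hp.2.1⟩)
    have hri := ihr hright hrm (by simp) (fun b => (hst b).mono rightPart_subset) (.inl rfl)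
    have hs := two hsm (fun b => (hleft.isCatalogue_of_some b).index_biased)
      fun b => beyond_stored (hleft.isCatalogue_of_some b)
        (fun p hp => (leftOwn_beyond hstrip hp).imp_right fun h q hq => h q (.inr hq))
        ((hst b).mono stripPart_subset)
    have hdecomp := setLIntegral_le_add_parts (r := r) (a := a) (lo := lo) (hi := hi) D Set.univ
      fun q => ((node a lo hi cat left right).indexCost q : ℝ≥0∞)
    simp only [Set.univ_inter] at hdecomp
    rw [setLIntegral_congr_fun hlm (g := fun q => (left.indexCost q : ℝ≥0∞)),
      setLIntegral_congr_fun hsm (g := fun q => (((left.cat .x).index.depth q.1 +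
        (left.cat .y).index.depth q.2 : ℕ) : ℝ≥0∞)),
      setLIntegral_congr_fun hrm (g := fun q => (right.indexCost q : ℝ≥0∞))] at hdecomp
    · refine hdecomp.trans ((add_le_add (add_le_add hl hs) hri).trans ?_)
      rw [← mul_add, ← mul_add]
      gcongr
      have hd1 : Disjoint (leftPart r a lo) (stripPart r a lo hi) :=
        Set.disjoint_left.2 fun q h1 h2 => absurd h1.2 (not_le.2 h2.2.1)
      have hd2 : Disjoint (leftPart r a lo ∪ stripPart r a lo hi) (rightPart r a hi) :=
        Set.disjoint_left.2 fun q h1 h2 => by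
          rcases h1 with h1 | h1
          · exact absurd h1.2 (not_le.2 (hstrip.lo_lt_hi.trans h2.2))
          · exact absurd h1.2.2 (not_le.2 h2.2)
      rw [← lintegral_union hsm hd1, ← lintegral_union hrm hd2]
      exact lintegral_mono_set (Set.union_subset (Set.union_subset leftPart_subset
        stripPart_subset) rightPart_subset)
    · intro q hq
      simp [indexCost, hq.2]
    · intro q hq
      simp [indexCost, not_lt.2 hq.2.2, not_le.2 hq.2.1]
    · intro q hq
      simp [indexCost, hq.2, not_lt.2 (hq.2.trans hstrip.lo_lt_hi.le)]

end PrimaryTree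

/-! ### Comparison of the expected times -/

/-- A biased range tree is within a constant factor of any comparison tree. -/
theorem IsBiasedRangeTree.expectedTime_le {κ ρ : ℕ} (hρ : 1 ≤ ρ) {S : Finset (ℝ × ℝ)}
    (hS : S.Nonempty) {D : Measure (ℝ × ℝ)} [IsProbabilityMeasure D] {T : BiasedRangeTree}
    (h : IsBiasedRangeTree κ ρ S D T) {t : ComparisonTree} (ht : t.Solves S) :
    T.expectedTime D ≤ ((2 * ρ + κ + 9) * 73 + 2 * (κ + 1) : ℕ) * t.expectedTime D := by
  have hm : Measurable fun q => (t.depth q : ℝ≥0∞) :=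
    measurable_from_top.comp t.measurable_depth
  have h1 := ComparisonTree.one_le_expectedTime hS ht D
  have hlev := h.primary.lintegral_level_le ht t.measurable_depth
  have hidx := h.primary.setLIntegral_indexCost_le ht MeasurableSet.univ (by simp)
    (by simp [Beyond]) (.inl rfl)
  rw [Measure.restrict_univ, lintegral_add_left hm, lintegral_const, measure_univ, mul_one] at hidx
  have hcl : ∫⁻ q, (T.primary.indexCost q : ℝ≥0∞) ∂D ≤ 2 * (κ + 1) * t.expectedTime D := by
    refine hidx.trans ?_
    rw [mul_assoc]
    gcongr
    rw [add_mul, one_mul, add_comm]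
    exact add_le_add (le_mul_of_one_le_right' h1) le_rfl
  have hml : Measurable fun q => (T.primary.level q : ℝ≥0∞) :=
    measurable_from_top.comp T.primary.measurable_level
  set K : ℕ := 2 * ρ + κ + 9 with hK
  have htime : ∀ q, (T.time q : ℝ≥0∞) ≤
      (K : ℝ≥0∞) * ((T.primary.level q : ℝ≥0∞) + 1) + T.primary.indexCost q := by
    intro q
    exact_mod_cast h.time_le hρ q
  -- The constant is 4 + 68 + 1, the additive part being absorbed by an expected time of at least 1.
  have hlev' : ∫⁻ q, ((T.primary.level q : ℝ≥0∞) + 1) ∂D ≤ 73 * t.expectedTime D := by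
    rw [lintegral_add_left hml, lintegral_const, measure_univ, mul_one]
    calc _ ≤ 4 * t.expectedTime D + 68 + 1 := add_le_add_left hlev 1
      _ = 4 * t.expectedTime D + 69 * 1 := by ring
      _ ≤ 4 * t.expectedTime D + 69 * t.expectedTime D := by gcongr
      _ = 73 * t.expectedTime D := by ring
  calc T.expectedTime D ≤ ∫⁻ q, ((K : ℝ≥0∞) * ((T.primary.level q : ℝ≥0∞) + 1) +
        T.primary.indexCost q) ∂D := lintegral_mono htime
    _ ≤ K * (73 * t.expectedTime D) + 2 * (κ + 1) * t.expectedTime D := by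
      rw [lintegral_add_left ((hml.add_const 1).const_mul _),
        lintegral_const_mul _ (hml.add_const 1)]
      exact add_le_add (mul_le_mul_right hlev' _) hcl
    _ = _ := by
      push_cast
      ring

/-! ### Existence of biased search trees -/

theorem exists_between_of_lt_of_le {c : ℕ → ℝ} {y : ℝ} {lo hi : ℕ} (h : lo ≤ hi) (hlo : c lo < y)
    (hhi : y ≤ c hi) : ∃ m, lo ≤ m ∧ m < hi ∧ c m < y ∧ y ≤ c (m + 1) := by
  induction hi, h using Nat.le_induction with
  | base => exact absurd hlo (not_lt.2 hhi)
  | succ n hn ih =>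
    by_cases hy : y ≤ c n
    · obtain ⟨m, h1, h2, h3⟩ := ih hy
      exact ⟨m, h1, by omega, h3⟩
    · exact ⟨n, hn, by omega, not_le.1 hy, hhi⟩

theorem le_getElem_iff_rank_le {L : List ℝ} (hL : L.Pairwise (· ≤ ·)) {m : ℕ} (hm : m < L.length)
    (z : ℝ) : z ≤ L[m] ↔ rank L z ≤ m := by
  rw [← not_lt, getElem_lt_iff_lt_rank hL, not_lt]

/-- Bisection of an interval that contains the points `c i`, which are at least `(w i + w j) / 2`
apart. -/
theorem exists_searchTree_bisection {L : List ℝ} (hL : L.Pairwise (· ≤ ·)) {w c : ℕ → ℝ} {ε : ℝ}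
    (hε : 0 < ε) (hw : ∀ i, ε ≤ w i) (hc : ∀ i j, i < j → w i / 2 + w j / 2 ≤ c j - c i) (N : ℕ) :
    ∀ (k lo hi : ℕ) (x : ℝ), lo ≤ hi → hi ≤ L.length →
      (∀ i, lo ≤ i → i ≤ hi → x ≤ c i ∧ c i < x + 2⁻¹ ^ k) → (2⁻¹ : ℝ) ^ (k + N) ≤ ε →
      ∃ t : SearchTree, ∀ z, lo ≤ rank L z → rank L z ≤ hi → t.find z = rank L z ∧
        (t.depth z = 0 ∨ w (rank L z) * 2 ^ (k + t.depth z) < 4) := by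
  have hmono : ∀ i j, i ≤ j → c i ≤ c j := by
    intro i j hij
    rcases hij.eq_or_lt with rfl | h
    · exact le_rfl
    · have := hc i j h
      have := hw i
      have := hw j
      linarith
  have single : ∀ k i : ℕ, ∃ t : SearchTree, ∀ z, i ≤ rank L z → rank L z ≤ i →
      t.find z = rank L z ∧ (t.depth z = 0 ∨ w (rank L z) * 2 ^ (k + t.depth z) < 4) :=
    fun k i => ⟨.leaf i, fun z h1 h2 => ⟨le_antisymm h1 h2, .inl rfl⟩⟩
  induction N with
  | zero =>
    intro k lo hi x hlohi hhi hx hk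
    rcases hlohi.eq_or_lt with rfl | hlt
    · exact single k lo
    -- Two centres would be at least ε apart in a half-open interval of length at most ε.
    · have := hc lo hi hlt
      have := hx lo le_rfl hlohi
      have := hx hi hlohi le_rfl
      have := hw lo
      have := hw hi
      rw [add_zero] at hk
      linarith
  | succ N ih =>
    intro k lo hi x hlohi hhi hx hk
    rcases hlohi.eq_or_lt with rfl | hlt
    · exact single k lo
    have hk' : (2⁻¹ : ℝ) ^ (k + 1 + N) ≤ ε := by rwa [add_assoc, add_comm 1 N]
    have hhalf : (2⁻¹ : ℝ) ^ (k + 1) + 2⁻¹ ^ (k + 1) = 2⁻¹ ^ k := by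
      rw [pow_succ]
      ring
    have hpos : ∀ i, 0 ≤ w i := fun i => hε.le.trans (hw i)
    have weaken : ∀ (t : SearchTree) (z : ℝ),
        (t.depth z = 0 ∨ w (rank L z) * 2 ^ (k + 1 + t.depth z) < 4) →
        (t.depth z = 0 ∨ w (rank L z) * 2 ^ (k + t.depth z) < 4) := by
      rintro t z (h | h)
      · exact .inl h
      · refine .inr (lt_of_le_of_lt (mul_le_mul_of_nonneg_left ?_ (hpos _)) h)
        exact pow_le_pow_right₀ one_le_two (by omega)
    -- If one half contains all the centres, the interval shrinks without a comparison.
    by_cases h1 : c hi < x + 2⁻¹ ^ (k + 1)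
    · obtain ⟨t, ht⟩ := ih (k + 1) lo hi x hlohi hhi
        (fun i hi1 hi2 => ⟨(hx i hi1 hi2).1, (hmono i hi hi2).trans_lt h1⟩) hk'
      exact ⟨t, fun z hz1 hz2 => (ht z hz1 hz2).imp_right (weaken t z)⟩
    by_cases h2 : x + 2⁻¹ ^ (k + 1) ≤ c lo
    · obtain ⟨t, ht⟩ := ih (k + 1) lo hi (x + 2⁻¹ ^ (k + 1)) hlohi hhi
        (fun i hi1 hi2 => ⟨h2.trans (hmono lo i hi1), by
          have := (hx i hi1 hi2).2
          linarith⟩) hk'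
      exact ⟨t, fun z hz1 hz2 => (ht z hz1 hz2).imp_right (weaken t z)⟩
    -- Both halves contain centres, the last one on the left being `c m`; comparing with `L[m]`
    -- separates the ranks up to `m` from the others.
    obtain ⟨m, hm1, hm2, hm3, hm4⟩ := exists_between_of_lt_of_le hlohi (not_le.1 h2) (not_lt.1 h1)
    obtain ⟨l, hl⟩ := ih (k + 1) lo m x hm1 (by omega)
      (fun i hi1 hi2 => ⟨(hx i hi1 (by omega)).1, (hmono i m hi2).trans_lt hm3⟩) hk'
    obtain ⟨r, hr⟩ := ih (k + 1) (m + 1) hi (x + 2⁻¹ ^ (k + 1)) hm2 hhi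
      (fun i hi1 hi2 => ⟨hm4.trans (hmono (m + 1) i hi1), by
        have := (hx i (by omega) hi2).2
        linarith⟩) hk'
    have hmL : m < L.length := by omega
    -- Another centre lies in the same interval of length 2^(-k), at a distance of more than `w i /
    -- 2`.
    have hsmall : ∀ i, lo ≤ i → i ≤ hi → w i * 2 ^ (k + 1) < 4 := by
      intro i hi1 hi2
      have h3 : w i < 2 * 2⁻¹ ^ k := by
        have h4 := hx i hi1 hi2
        rcases hi1.eq_or_lt with rfl | h5
        · have := hc _ _ hlt
          have := hx hi hlohi le_rfl
          have := hw hi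
          linarith
        · have := hc _ _ h5
          have := hx lo le_rfl hlohi
          have := hw lo
          linarith
      calc w i * 2 ^ (k + 1) < 2 * 2⁻¹ ^ k * 2 ^ (k + 1) := by gcongr
        _ = 4 * (2⁻¹ * 2) ^ k := by rw [pow_succ, mul_pow]; ring
        _ = 4 := by norm_num
    have step : ∀ (t : SearchTree) (z : ℝ), lo ≤ rank L z → rank L z ≤ hi →
        (t.depth z = 0 ∨ w (rank L z) * 2 ^ (k + 1 + t.depth z) < 4) →
        w (rank L z) * 2 ^ (k + (t.depth z + 1)) < 4 := by
      rintro t z hz1 hz2 (h | h)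
      · rw [h]
        exact hsmall _ hz1 hz2
      · rwa [add_comm (t.depth z) 1, ← add_assoc]
    refine ⟨.node L[m] l r, fun z hz1 hz2 => ?_⟩
    by_cases hz : z ≤ L[m]
    · have h5 := (le_getElem_iff_rank_le hL hmL z).1 hz
      simp only [SearchTree.find, SearchTree.depth, hz, if_true]
      exact (hl z hz1 h5).imp_right fun h => .inr (step l z hz1 hz2 h)
    · have h5 := (le_getElem_iff_rank_le hL hmL z).not.1 hz
      simp only [SearchTree.find, SearchTree.depth, hz, if_false]
      exact (hr z (by omega) hz2).imp_right fun h => .inr (step r z hz1 hz2 h)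

/-- For all weights `p i` with sum one there is a search tree such that the intervals `i` have depth
at most `log₂ (1 / p i) + 3`. -/
theorem exists_searchTree_mul_pow_depth_le {L : List ℝ} (hL : L.Pairwise (· ≤ ·)) {p : ℕ → ℝ}
    (hp : ∀ i, 0 ≤ p i) (hsum : ∑ i ∈ Finset.range (L.length + 1), p i = 1) :
    ∃ t : SearchTree, ∀ z, t.find z = rank L z ∧ p (rank L z) * 2 ^ t.depth z ≤ 8 := by
  set n := L.length
  have hn : (0 : ℝ) < n + 1 := by positivity
  -- Averaging with the uniform distribution bounds all weights away from zero, so that the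
  -- bisection ends. The price is a factor 2, which turns the bound 4 into 8. The `c i` are the
  -- midpoints of consecutive intervals of lengths `w i`.
  set w : ℕ → ℝ := fun i => (p i + 1 / (n + 1)) / 2 with hw
  set c : ℕ → ℝ := fun i => ∑ j ∈ Finset.range i, w j + w i / 2 with hc
  have hε : (0 : ℝ) < 1 / (n + 1) / 2 := by positivity
  have hwε : ∀ i, 1 / ((n : ℝ) + 1) / 2 ≤ w i := by
    intro i
    have := hp i
    simp only [hw]
    linarith
  have hw0 : ∀ i, 0 ≤ w i := fun i => hε.le.trans (hwε i)
  have hmono : ∀ i j, i ≤ j → ∑ l ∈ Finset.range i, w l ≤ ∑ l ∈ Finset.range j, w l := by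
    intro i j hij
    exact Finset.sum_le_sum_of_subset_of_nonneg (Finset.range_mono hij) fun l _ _ => hw0 l
  have htot : ∑ l ∈ Finset.range (n + 1), w l = 1 := by
    simp only [hw]
    rw [← Finset.sum_div, Finset.sum_add_distrib, hsum]
    simp only [Finset.sum_const, Finset.card_range, nsmul_eq_mul]
    push_cast
    field_simp
    norm_num
  have hgap : ∀ i j, i < j → w i / 2 + w j / 2 ≤ c j - c i := by
    intro i j hij
    have h1 := hmono (i + 1) j hij
    rw [Finset.sum_range_succ] at h1
    simp only [hc]
    linarith
  obtain ⟨N, hN⟩ := exists_pow_lt_of_lt_one hε (by norm_num : (2⁻¹ : ℝ) < 1)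
  obtain ⟨t, ht⟩ := exists_searchTree_bisection hL hε hwε hgap N 0 0 n 0 (Nat.zero_le _) le_rfl
    (fun i _ hi => ⟨by
      have := hw0 i
      have : 0 ≤ ∑ l ∈ Finset.range i, w l := Finset.sum_nonneg fun l _ => hw0 l
      simp only [hc]
      linarith, by
      have h1 := hmono (i + 1) (n + 1) (by omega)
      rw [htot, Finset.sum_range_succ] at h1
      have := hwε i
      simp only [hc]
      rw [pow_zero]
      linarith⟩) (by simpa using hN.le)
  refine ⟨t, fun z => ?_⟩
  have hz := rank_le_length L z
  obtain ⟨h1, h2⟩ := ht z (Nat.zero_le _) hz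
  refine ⟨h1, ?_⟩
  rcases h2 with h2 | h2
  · have h3 : p (rank L z) ≤ 1 := hsum ▸
      Finset.single_le_sum (fun i _ => hp i) (Finset.mem_range.2 (Nat.lt_succ_of_le hz))
    rw [h2]
    linarith
  · rw [zero_add] at h2
    have h3 : p (rank L z) ≤ 2 * w (rank L z) := by
      have : (0 : ℝ) ≤ 1 / (n + 1) := by positivity
      simp only [hw]
      linarith
    have h4 := mul_le_mul_of_nonneg_right h3 (by positivity : (0 : ℝ) ≤ 2 ^ t.depth z)
    linarith

open Real in
theorem natCast_le_of_mul_two_pow_le {p : ℝ} (hp : 0 < p) {d : ℕ} (h : p * 2 ^ d ≤ 8) :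
    (d : ℝ) ≤ -log p / log 2 + 3 := by
  have hlog : 0 < log 2 := log_pos one_lt_two
  have h1 := log_le_log (by positivity) h
  rw [log_mul hp.ne' (by positivity), log_pow, show (8 : ℝ) = 2 ^ 3 by norm_num, log_pow] at h1
  rw [div_add' _ _ _ hlog.ne', le_div_iff₀ hlog]
  push_cast at h1
  linarith

open Real in
theorem exists_isBiasedSearchTree_of_isProbabilityMeasure {L : List ℝ} (hL : L.Pairwise (· ≤ ·))
    {κ : ℕ} (hκ : 3 ≤ κ) (P : Measure (ℝ × ℝ)) [IsProbabilityMeasure P] (a : Axis) :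
    ∃ t, IsBiasedSearchTree κ P a L t := by
  set E : ℕ → Set (ℝ × ℝ) := fun i => {q | rank L (a.coord q) = i} with hE
  have hEm : ∀ i, MeasurableSet (E i) := fun i =>
    (measurable_rank L).comp a.measurable_coord (measurableSet_singleton i)
  have hdisj : Set.PairwiseDisjoint (Finset.range (L.length + 1) : Set ℕ) E := by
    intro i _ j _ hij
    exact Set.disjoint_left.2 fun q hi hj => hij (hi.symm.trans hj)
  have hunion : ⋃ i ∈ Finset.range (L.length + 1), E i = Set.univ := by
    rw [Set.eq_univ_iff_forall]
    intro q
    rw [Set.mem_iUnion₂]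
    exact ⟨_, Finset.mem_range.2 (Nat.lt_succ_of_le (rank_le_length L (a.coord q))), rfl⟩
  have hsum : ∑ i ∈ Finset.range (L.length + 1), P.real (E i) = 1 := by
    rw [← measureReal_biUnion_finset hdisj fun i _ => hEm i, hunion, probReal_univ]
  obtain ⟨t, ht⟩ := exists_searchTree_mul_pow_depth_le hL
    (fun i => measureReal_nonneg (μ := P) (s := E i)) hsum
  refine ⟨t, fun z => (ht z).1, ?_⟩
  have hlog : 0 < log 2 := log_pos one_lt_two
  have hnn : ∀ i, 0 ≤ negMulLog (P.real (E i)) / log 2 + 3 * P.real (E i) := fun i =>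
    add_nonneg (div_nonneg (negMulLog_nonneg measureReal_nonneg measureReal_le_one) hlog.le)
      (mul_nonneg (by norm_num) measureReal_nonneg)
  have hpart : ∀ i, ∫⁻ q in E i, (t.depth (a.coord q) : ℝ≥0∞) ∂P ≤
      ENNReal.ofReal (negMulLog (P.real (E i)) / log 2 + 3 * P.real (E i)) := by
    intro i
    rcases (measureReal_nonneg (μ := P) (s := E i)).eq_or_lt with h0 | hpos
    · rw [Measure.restrict_eq_zero.2 ((measureReal_eq_zero_iff).1 h0.symm)]
      simp
    · have hle : ∀ q ∈ E i, (t.depth (a.coord q) : ℝ≥0∞) ≤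
          ENNReal.ofReal (-log (P.real (E i)) / log 2 + 3) := by
        intro q hq
        have h1 := (ht (a.coord q)).2
        rw [show rank L (a.coord q) = i from hq] at h1
        rw [← ENNReal.ofReal_natCast]
        exact ENNReal.ofReal_le_ofReal (natCast_le_of_mul_two_pow_le hpos h1)
      refine (setLIntegral_mono' (hEm i) hle).trans_eq ?_
      rw [lintegral_const, Measure.restrict_apply_univ, ← ofReal_measureReal,
        ← ENNReal.ofReal_mul' measureReal_nonneg]
      congr 1
      rw [negMulLog]
      ring
  rw [← setLIntegral_univ, ← hunion, lintegral_biUnion_finset hdisj fun i _ => hEm i]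
  refine (Finset.sum_le_sum fun i _ => hpart i).trans ?_
  rw [← ENNReal.ofReal_sum_of_nonneg fun i _ => hnn i]
  refine ENNReal.ofReal_le_ofReal ?_
  rw [Finset.sum_add_distrib, ← Finset.mul_sum, hsum, mul_one, intervalEntropy]
  have : (3 : ℝ) ≤ κ := by exact_mod_cast hκ
  gcongr

theorem exists_isBiasedSearchTree_cond {L : List ℝ} (hL : L.Pairwise (· ≤ ·)) {κ : ℕ}
    (hκ : 3 ≤ κ) (D : Measure (ℝ × ℝ)) [IsFiniteMeasure D] (s : Set (ℝ × ℝ)) (a : Axis) :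
    ∃ t, IsBiasedSearchTree κ (ProbabilityTheory.cond D s) a L t := by
  by_cases h0 : D s = 0
  -- The conditional measure is zero, so cost is no issue; the Dirac measure only supplies a tree
  -- that finds the right intervals.
  · obtain ⟨t, ht⟩ := exists_isBiasedSearchTree_of_isProbabilityMeasure hL hκ
      (Measure.dirac (0 : ℝ × ℝ)) a
    refine ⟨t, ht.find_eq, ?_⟩
    rw [ProbabilityTheory.cond_eq_zero_of_meas_eq_zero h0]
    simp
  · have := ProbabilityTheory.cond_isProbabilityMeasure h0
    exact exists_isBiasedSearchTree_of_isProbabilityMeasure hL hκ _ a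

/-! ### Existence of biased range trees -/

theorem rightPart_top (r : Set (ℝ × ℝ)) (a : Axis) : rightPart r a ⊤ = ∅ := by
  simp [rightPart]

theorem leftPart_bot (r : Set (ℝ × ℝ)) (a : Axis) : leftPart r a ⊥ = ∅ := by
  simp [leftPart]

theorem measure_leftPart_add_rightPart (D : Measure (ℝ × ℝ)) (r : Set (ℝ × ℝ)) (a : Axis)
    (lo : EReal) : D (leftPart r a lo) + D (rightPart r a lo) = D r := by
  rw [← measure_inter_add_sdiff r (a.measurable_coe_coord (measurableSet_Iic (a := lo)))]
  congr 2
  ext q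
  simp [rightPart]

/-- Let `hi` be the first line with less than half of the probability to its right, and `lo` the
line before it. By minimality at least half lies to the right of `lo`, hence at most half to its
left. For a null region every line qualifies as `hi`. -/
theorem exists_isSplitStrip (S : Finset (ℝ × ℝ)) (D : Measure (ℝ × ℝ)) [IsFiniteMeasure D]
    (r : Set (ℝ × ℝ)) (a : Axis) : ∃ lo hi, IsSplitStrip S D r a lo hi := by
  classical
  set X : Finset EReal := (S.filter (· ∈ r)).image fun p => (a.coord p : EReal) with hX
  have memX : ∀ y, y ∈ X ↔ ∃ p ∈ S, p ∈ r ∧ y = (a.coord p : EReal) := by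
    intro y
    simp only [hX, Finset.mem_image, Finset.mem_filter, and_assoc, eq_comm (a := y)]
  set V := (insert ⊤ X).filter fun h => D r ≠ 0 → D (rightPart r a h) < D r / 2 with hV
  have hVne : V.Nonempty := by
    refine ⟨⊤, Finset.mem_filter.2 ⟨Finset.mem_insert_self _ _, fun h0 => ?_⟩⟩
    rw [rightPart_top, measure_empty]
    exact ENNReal.half_pos h0
  obtain ⟨hi, hhi, hmin⟩ := V.exists_min_image id hVne
  rw [hV, Finset.mem_filter, Finset.mem_insert] at hhi
  have hibot : ⊥ < hi := by
    rcases hhi.1 with rfl | h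
    · exact bot_lt_top
    · obtain ⟨p, _, _, rfl⟩ := (memX _).1 h
      exact EReal.bot_lt_coe _
  set U := (insert ⊥ X).filter fun h => h < hi with hU
  obtain ⟨lo, hlo, hmax⟩ := U.exists_max_image id
    ⟨⊥, Finset.mem_filter.2 ⟨Finset.mem_insert_self _ _, hibot⟩⟩
  rw [hU, Finset.mem_filter, Finset.mem_insert] at hlo
  refine ⟨lo, hi, hlo.1.imp_right (memX _).1, hhi.1.imp_right (memX _).1, hlo.2, ?_, ?_, ?_, hhi.2⟩
  · intro p hp hr
    rcases lt_or_ge (a.coord p : EReal) hi with h | h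
    · exact .inl (hmax _ (Finset.mem_filter.2
        ⟨Finset.mem_insert_of_mem ((memX _).2 ⟨p, hp, hr, rfl⟩), h⟩))
    · exact .inr h
  · rcases hlo.1 with rfl | h
    · simp [leftPart_bot]
    · have hnot : ¬ (D r ≠ 0 → D (rightPart r a lo) < D r / 2) := fun h' =>
        absurd (hmin lo (Finset.mem_filter.2 ⟨Finset.mem_insert_of_mem h, h'⟩)) (not_le.2 hlo.2)
      push Not at hnot
      have hfin : D (rightPart r a lo) ≠ ∞ := measure_ne_top _ _
      rw [← ENNReal.add_le_add_iff_right hfin, measure_leftPart_add_rightPart]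
      calc D r = D r / 2 + D r / 2 := (ENNReal.add_halves _).symm
        _ ≤ _ := by gcongr; exact hnot.2
  · by_cases h0 : D r = 0
    · exact (measure_mono rightPart_subset).trans (by simp [h0])
    · exact (hhi.2 h0).le

theorem exists_eq_comp_rank {L : List ℝ} {f : ℝ → ℕ}
    (hf : ∀ y z, rank L y = rank L z → f y = f z) : ∃ g : ℕ → ℕ, ∀ z, g (rank L z) = f z := by
  have hfac : f.FactorsThrough (rank L) := fun y z h => hf y z h
  obtain ⟨g, hg⟩ := (Function.factorsThrough_iff f).1 hfac
  exact ⟨g, fun z => (congrFun hg z).symm⟩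

theorem exists_isCatalogue {κ : ℕ} (hκ : 3 ≤ κ) (ρ : ℕ) (D : Measure (ℝ × ℝ)) [IsFiniteMeasure D]
    (s : Set (ℝ × ℝ)) (a : Axis) (own : Finset (ℝ × ℝ)) (parent : List ℝ) :
    ∃ C, IsCatalogue κ ρ (ProbabilityTheory.cond D s) a own parent C := by
  set M : Multiset ℝ := own.val.map a.coord + (sample ρ parent : Multiset ℝ) with hM
  set L : List ℝ := M.sort (· ≤ ·) with hLdef
  have hL : L.Pairwise (· ≤ ·) := Multiset.pairwise_sort M (· ≤ ·)
  have hmem : ∀ x, x ∈ L ↔ x ∈ M := fun x => Multiset.mem_sort (· ≤ ·)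
  obtain ⟨count, hcount⟩ := exists_eq_comp_rank (L := L)
    (f := fun z => (own.filter fun p => z ≤ a.coord p).card) <| by
      intro y z h
      congr 1
      refine Finset.filter_congr fun p hp => ?_
      have h1 := lt_iff_lt_of_rank_eq h (a.coord p) ((hmem _).2 (Multiset.mem_add.2
        (.inl (Multiset.mem_map_of_mem _ hp))))
      rw [← not_lt, h1, not_lt]
  obtain ⟨bridge, hbridge⟩ := exists_eq_comp_rank (L := L)
    (f := fun z => ρ * rank (sample ρ parent) z) <| by
      intro y z h
      congr 1
      refine List.countP_congr fun x hx => ?_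
      have h1 := lt_iff_lt_of_rank_eq h x ((hmem _).2 (Multiset.mem_add.2 (.inr hx)))
      simpa using h1
  obtain ⟨t, ht⟩ := exists_isBiasedSearchTree_cond hL hκ D s a
  exact ⟨⟨L, count, bridge, t⟩, hL, Multiset.sort_eq M (· ≤ ·), hcount, hbridge, ht⟩

theorem PrimaryTree.exists_isFor {κ : ℕ} (hκ : 3 ≤ κ) (ρ : ℕ) (S : Finset (ℝ × ℝ))
    (D : Measure (ℝ × ℝ)) [IsFiniteMeasure D] (n : ℕ) :
    ∀ (d : ℕ) (r : Set (ℝ × ℝ)) (own : Axis → Finset (ℝ × ℝ)) (up : Axis → List ℝ)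
      (W : Option (Set (ℝ × ℝ))), Nat.clog 2 S.card ≤ d + n →
      ∃ t : PrimaryTree, t.IsFor κ ρ S D d r own up W := by
  classical
  have hleaf : ∀ (d : ℕ) (r : Set (ℝ × ℝ)) (own : Axis → Finset (ℝ × ℝ)) (up : Axis → List ℝ)
      (W : Option (Set (ℝ × ℝ))), ¬ IsSplit S d r →
      ∃ t : PrimaryTree, t.IsFor κ ρ S D d r own up W := by
    intro d r own up W h
    choose cat hcat using fun b => exists_isCatalogue hκ ρ D (W.getD r) b (own b) (up b)
    exact ⟨.leaf (decide (∃ p ∈ S, p ∈ r)) cat, h, decide_eq_true_iff, hcat⟩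
  induction n with
  | zero => exact fun d r own up W hd => hleaf d r own up W fun h => absurd h.1 (not_lt.2 hd)
  | succ n ih =>
    intro d r own up W hd
    by_cases hs : IsSplit S d r
    · obtain ⟨lo, hi, hstrip⟩ := exists_isSplitStrip S D r (axisAt d)
      choose cat hcat using fun b =>
        exists_isCatalogue hκ ρ D (W.getD (stripPart r (axisAt d) lo hi)) b (own b) (up b)
      obtain ⟨left, hl⟩ := ih (d + 1) (leftPart r (axisAt d) lo) (leftOwn S r (axisAt d) lo hi)
        (fun b => (cat b).stored) (some (stripPart r (axisAt d) lo hi)) (by omega)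
      obtain ⟨right, hr⟩ := ih (d + 1) (rightPart r (axisAt d) hi) (fun _ => ∅)
        (fun b => (cat b).stored) none (by omega)
      exact ⟨.node (axisAt d) lo hi cat left right, hs, rfl, hstrip, hcat, hl, hr⟩
    · exact hleaf d r own up W hs

/-- Binary search. -/
theorem ComparisonTree.exists_binarySearch {L : List ℝ} (hL : L.Pairwise (· ≤ ·)) (a : Axis)
    (f : ℕ → ComparisonTree) (N : ℕ) :
    ∀ lo hi : ℕ, lo ≤ hi → hi ≤ L.length → hi - lo + 1 ≤ 2 ^ N →
      ∃ t : ComparisonTree, ∀ q, lo ≤ rank L (a.coord q) → rank L (a.coord q) ≤ hi →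
        t.eval q = (f (rank L (a.coord q))).eval q ∧
        t.depth q ≤ (f (rank L (a.coord q))).depth q + N := by
  have single : ∀ N i : ℕ, ∃ t : ComparisonTree, ∀ q, i ≤ rank L (a.coord q) →
      rank L (a.coord q) ≤ i → t.eval q = (f (rank L (a.coord q))).eval q ∧
        t.depth q ≤ (f (rank L (a.coord q))).depth q + N := by
    refine fun N i => ⟨f i, fun q h1 h2 => ?_⟩
    rw [le_antisymm h2 h1]
    exact ⟨rfl, Nat.le_add_right _ _⟩
  induction N with
  | zero =>
    intro lo hi h1 h2 h3
    obtain rfl : lo = hi := by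
      rw [pow_zero] at h3
      omega
    exact single 0 lo
  | succ N ih =>
    intro lo hi h1 h2 h3
    rcases h1.eq_or_lt with rfl | hlt
    · exact single _ lo
    rw [pow_succ] at h3
    obtain ⟨yes, hyes⟩ := ih lo ((lo + hi) / 2) (by omega) (by omega) (by omega)
    obtain ⟨no, hno⟩ := ih ((lo + hi) / 2 + 1) hi (by omega) h2 (by omega)
    have hm : (lo + hi) / 2 < L.length := by omega
    refine ⟨.node a L[(lo + hi) / 2] false yes no, fun q hq1 hq2 => ?_⟩
    have hiff : Test a L[(lo + hi) / 2] false q ↔ rank L (a.coord q) ≤ (lo + hi) / 2 := by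
      simp only [Test, Bool.false_eq_true, if_false]
      exact le_getElem_iff_rank_le hL hm _
    by_cases hq : rank L (a.coord q) ≤ (lo + hi) / 2
    · obtain ⟨h4, h5⟩ := hyes q hq1 hq
      simp only [eval, depth, hiff, hq, if_true]
      exact ⟨h4, by omega⟩
    · obtain ⟨h4, h5⟩ := hno q (by omega) hq2
      simp only [eval, depth, hiff, hq, if_false]
      exact ⟨h4, by omega⟩

theorem exists_sorted_coords (S : Finset (ℝ × ℝ)) (a : Axis) :
    ∃ L : List ℝ, L.Pairwise (· ≤ ·) ∧ L.length = S.card ∧ ∀ p ∈ S, a.coord p ∈ L :=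
  ⟨(S.val.map a.coord).sort (· ≤ ·), Multiset.pairwise_sort _ _, by simp,
    fun _ hp => (Multiset.mem_sort _).2 (Multiset.mem_map_of_mem _ hp)⟩

/-- Binary search for the rank of one coordinate and then of the other: n+1 ranks are told apart by
⌈log n⌉+1 comparisons. -/
theorem ComparisonTree.exists_solves (S : Finset (ℝ × ℝ)) :
    ∃ t : ComparisonTree, t.Solves S ∧ ∀ q, t.depth q ≤ 2 * (Nat.clog 2 S.card + 1) := by
  classical
  obtain ⟨X, hX, hXlen, hXmem⟩ := exists_sorted_coords S .x
  obtain ⟨Y, hY, hYlen, hYmem⟩ := exists_sorted_coords S .y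
  set N := Nat.clog 2 S.card + 1 with hN
  have hlen : S.card - 0 + 1 ≤ 2 ^ N := by
    have h1 : S.card ≤ 2 ^ Nat.clog 2 S.card := Nat.le_pow_clog one_lt_two _
    have h2 : 1 ≤ 2 ^ Nat.clog 2 S.card := Nat.one_le_two_pow
    rw [hN, pow_succ]
    omega
  obtain ⟨g, hg⟩ : ∃ g : ℕ × ℕ → ℕ, ∀ q : ℝ × ℝ, g (rank X q.1, rank Y q.2) = rangeCount S q := by
    have hf : (rangeCount S).FactorsThrough fun q => (rank X q.1, rank Y q.2) := by
      intro q q' h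
      rw [Prod.mk.injEq] at h
      rw [rangeCount, rangeCount]
      congr 1
      refine Finset.filter_congr fun p hp => ?_
      have h1 := lt_iff_lt_of_rank_eq h.1 p.1 (hXmem p hp)
      have h2 := lt_iff_lt_of_rank_eq h.2 p.2 (hYmem p hp)
      rw [← not_lt, ← not_lt, h1, h2, not_lt, not_lt]
    obtain ⟨g, hg⟩ := (Function.factorsThrough_iff _).1 hf
    exact ⟨g, fun q => (congrFun hg q).symm⟩
  choose u hu using fun i : ℕ => exists_binarySearch hY .y (fun j => leaf (g (i, j))) N 0 Y.length
    (Nat.zero_le _) le_rfl (by rwa [hYlen])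
  obtain ⟨t, ht⟩ := exists_binarySearch hX .x u N 0 X.length (Nat.zero_le _) le_rfl (by rwa [hXlen])
  refine ⟨t, fun q => ?_, fun q => ?_⟩
  · rw [(ht q (Nat.zero_le _) (rank_le_length _ _)).1,
      (hu _ q (Nat.zero_le _) (rank_le_length _ _)).1]
    exact hg q
  · have h1 := (ht q (Nat.zero_le _) (rank_le_length _ _)).2
    have h2 := (hu (rank X (Axis.x.coord q)) q (Nat.zero_le _) (rank_le_length _ _)).2
    simp only [depth] at h2
    omega

theorem exists_isBiasedRangeTree {κ : ℕ} (hκ : 3 ≤ κ) (ρ : ℕ) (S : Finset (ℝ × ℝ))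
    (D : Measure (ℝ × ℝ)) [IsFiniteMeasure D] :
    ∃ T, IsBiasedRangeTree κ ρ S D T := by
  obtain ⟨t, ht⟩ := PrimaryTree.exists_isFor hκ ρ S D (Nat.clog 2 S.card) 0 Set.univ (fun _ => ∅)
    (fun _ => []) none (by omega)
  obtain ⟨b, hb, hd⟩ := ComparisonTree.exists_solves S
  exact ⟨⟨t, b⟩, ht, hb, fun q => (hd q).trans (Nat.mul_le_mul_right _ (by omega))⟩

/-! ### The main theorem -/

theorem mainTheorem1 :
    (∃ κ₀ : ℕ, ∀ κ ρ : ℕ, κ₀ ≤ κ → 1 ≤ ρ →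
      ∀ (S : Finset (ℝ × ℝ)), S.Nonempty → ∀ (D : Measure (ℝ × ℝ)) [IsProbabilityMeasure D],
        ∃ T : BiasedRangeTree, IsBiasedRangeTree κ ρ S D T) ∧
    ∀ κ ρ : ℕ, 1 ≤ ρ → ∃ c : ℝ≥0, 0 < c ∧
      ∀ (S : Finset (ℝ × ℝ)), S.Nonempty → ∀ (D : Measure (ℝ × ℝ)) [IsProbabilityMeasure D],
        ∀ T : BiasedRangeTree, IsBiasedRangeTree κ ρ S D T →
          (∀ q, T.answer q = rangeCount S q) ∧
          ∀ Tstar : ComparisonTree, Tstar.Solves S →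
            (c : ℝ≥0∞) * T.expectedTime D ≤ Tstar.expectedTime D := by
  refine ⟨⟨3, fun κ ρ hκ _ S _ D _ => exists_isBiasedRangeTree hκ ρ S D⟩, fun κ ρ hρ => ?_⟩
  have hK : (((2 * ρ + κ + 9) * 73 + 2 * (κ + 1) : ℕ) : ℝ≥0) ≠ 0 :=
    Nat.cast_ne_zero.2 (by omega)
  refine ⟨(((2 * ρ + κ + 9) * 73 + 2 * (κ + 1) : ℕ) : ℝ≥0)⁻¹, inv_pos.2 (pos_iff_ne_zero.2 hK),
    fun S hS D _ T hT => ⟨hT.answer_eq hρ, fun t ht => ?_⟩⟩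
  refine (mul_le_mul_right (hT.expectedTime_le hρ hS ht) _).trans_eq ?_
  rw [← mul_assoc, ENNReal.coe_inv hK, ENNReal.coe_natCast, ENNReal.inv_mul_cancel, one_mul]
  · exact_mod_cast hK
  · exact ENNReal.natCast_ne_top _
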